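/- Let $\mathcal T=\{(x,y): 0\le y\le x\le 1\}$ and let $B_g,B_{g'},B_f,B_{f_x}>0$. There is $\epsilon^*=\epsilon^*(B_g,B_{g'},B_f,B_{f_x})>0$ such that the following holds for all $g\in C^1([0,1])$ and $f\in C^1(\mathcal T)$ whose first derivatives are Lipschitz and which satisfy $\|g\|_\infty\le B_g$, $\|g'\|_\infty\le B_{g'}$, $\|f\|_\infty\le B_f$, $\|f_x\|_\infty\le B_{f_x}$. There is exactly one $k\in C^1(\mathcal T)$ (the exact backstepping kernel) such that for all $(x,y)\in\mathcal T$ $$k(x,y)=-g(x-y)-\int_0^y f(x-y+\xi,\xi)\,d\xi+\int_0^{x-y}g(\xi)k(x-y,\xi)\,d\xi+\int_0^y\!\int_0^{x-y}f(\xi+\eta,\eta)\,k(x-y+\eta,\xi+\eta)\,d\xi\,d\eta .$$ Let $\epsilon\in(0,\epsilon^*)$ and let $\hat k\in C^1(\mathcal T)$ (for instance, the output of a neural operator) satisfy, with $\tilde k=k-\hat k$, $$|\tilde k(x,y)|+|\tilde k_x(x,y)|+|\tilde k_y(x,y)|<\epsilon\qquad\text{for all }(x,y)\in\mathcal T .$$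 Then there exist $M,c^*>0$ such that every solution $u$ of the closed-loop system $$u_t(x,t)=u_x(x,t)+g(x)u(0,t)+\int_0^x f(x,y)u(y,t)\,dy,\quad x\in[0,1),\qquad u(1,t)=\int_0^1\hat k(1,y)u(y,t)\,dy,$$ satisfies $$\|u(t)\|\le M e^{-c^*t/2}\|u(0)\|\qquad\text{for all }t\ge 0,$$ where $\|\cdot\|$ is the norm of $L^2(0,1)$. Here a solution of $u_t=u_x+g\,u(0,t)+\int_0^x f u$, $u(1,t)=U(t)$ is meant in the weak sense: $u\in C([0,\infty);L^2(0,1))$, $U\in L^2_{loc}([0,\infty))$, and there is a trace $h\in L^2_{loc}([0,\infty))$ (standing for $u(0,\cdot)$) such that for all $T>0$ and all $\varphi\in C^1(\mathbb R^2)$ $$\int_0^1 u(x,T)\varphi(x,T)\,dx-\int_0^1u(x,0)\varphi(x,0)\,dx=\int_0^T\Big[\int_0^1u(\varphi_t-\varphi_x)\,dx+U(t)\varphi(1,t)-h(t)\varphi(0,t)+\int_0^1\Big(g(x)h(t)+\int_0^xf(x,y)u(y,t)\,dy\Big)\varphi(x,t)\,dx\Big]dt .$$ -/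

import Mathlib

open Set MeasureTheory

noncomputable section

/-- The closed triangle `0 ≤ y ≤ x ≤ 1`, the domain of the plant kernel and of the gain kernels. -/
def triangle : Set (ℝ × ℝ) := {p | 0 ≤ p.2 ∧ p.2 ≤ p.1 ∧ p.1 ≤ 1}

/-- Partial derivative in the first variable of a function on the closed triangle. -/
def partialX (F : ℝ × ℝ → ℝ) (p : ℝ × ℝ) : ℝ := fderivWithin ℝ F triangle p (1, 0)

/-- Partial derivative in the second variable of a function on the closed triangle. -/
def partialY (F : ℝ × ℝ → ℝ) (p : ℝ × ℝ) : ℝ := fderivWithin ℝ F triangle p (0, 1)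

/-- `k` is a `C¹` solution on the triangle of the backstepping kernel equation
`k = F₀ + F(g, f, k)` for the coefficients `g`, `f`. -/
structure IsBacksteppingKernel (g : ℝ → ℝ) (f k : ℝ × ℝ → ℝ) : Prop where
  contDiffOn : ContDiffOn ℝ 1 k triangle
  kernel_eq : ∀ x y : ℝ, (x, y) ∈ triangle →
    k (x, y) =
      (-g (x - y) - ∫ ξ in (0 : ℝ)..y, f (x - y + ξ, ξ))
      + ((∫ ξ in (0 : ℝ)..(x - y), g ξ * k (x - y, ξ))
        + ∫ η in (0 : ℝ)..y, ∫ ξ in (0 : ℝ)..(x - y),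
            f (ξ + η, η) * k (x - y + η, ξ + η))

/-- The approximation `khat` of `k` has accuracy `ε` in value and in both first partial
derivatives, pointwise on the triangle. -/
def ApproximatesWithin (ε : ℝ) (k khat : ℝ × ℝ → ℝ) : Prop :=
  ∀ p ∈ triangle,
    |k p - khat p| + |partialX (fun q => k q - khat q) p|
      + |partialY (fun q => k q - khat q) p| < ε

/-- The state space `L²(0, 1)`. -/
abbrev StateL2 : Type := Lp ℝ 2 ((volume : Measure ℝ).restrict (Icc 0 1))

/-- `u` is a weak solution, for `t ≥ 0`, of
`u_t(x,t) = u_x(x,t) + g(x) u(0,t) + ∫_0^x f(x,y) u(y,t) dy`, `u(1,t) = U(t)`: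
a continuous curve in `L²(0, 1)` with an outlet trace `h(t) = u(0,t)` in `L²_loc([0, ∞))`,
for which the equation holds when it is multiplied by an arbitrary `C¹` test function `φ(x,t)`
and integrated by parts over `[0, 1] × [0, T]`. -/
def IsWeakSolution (g : ℝ → ℝ) (f : ℝ × ℝ → ℝ) (U : ℝ → ℝ) (u : ℝ → StateL2) : Prop :=
  ContinuousOn u (Ici 0) ∧
  (∀ T : ℝ, 0 < T → MemLp U 2 (volume.restrict (Icc 0 T))) ∧
  ∃ h : ℝ → ℝ,
    (∀ T : ℝ, 0 < T → MemLp h 2 (volume.restrict (Icc 0 T))) ∧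
    ∀ T : ℝ, 0 < T → ∀ φ : ℝ × ℝ → ℝ, ContDiff ℝ 1 φ →
      (∫ x in (0 : ℝ)..1, u T x * φ (x, T)) - (∫ x in (0 : ℝ)..1, u 0 x * φ (x, 0)) =
        ∫ t in (0 : ℝ)..T,
          ((∫ x in (0 : ℝ)..1,
              u t x * (fderiv ℝ φ (x, t) (0, 1) - fderiv ℝ φ (x, t) (1, 0)))
            + U t * φ (1, t) - h t * φ (0, t)
            + ∫ x in (0 : ℝ)..1,
                (g x * h t + ∫ y in (0 : ℝ)..x, f (x, y) * u t y) * φ (x, t))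

/-- The feedback law `U(t) = ∫_0^1 khat(1,y) u(y,t) dy`. -/
def feedback (khat : ℝ × ℝ → ℝ) (u : ℝ → StateL2) (t : ℝ) : ℝ :=
  ∫ y in (0 : ℝ)..1, khat (1, y) * u t y

/-- `u` is a solution of the closed loop of the plant with the feedback law of gain `khat`. -/
def IsClosedLoopSolution (g : ℝ → ℝ) (f khat : ℝ × ℝ → ℝ) (u : ℝ → StateL2) : Prop :=
  IsWeakSolution g f (feedback khat u) u

end

/-! In the characteristic coordinates `(x - y, y)` the kernel equation is an affine Volterra
fixed-point problem. Weighting the sup norm by an exponential in `x - y` turns it into a contraction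
of ratio 1/2 (`exists_continuous_kernel`). This gives existence, uniqueness and a bound `κ` on `k`
that depends only on `Bg` and `Bf`; applying the operator twice to the fixed point makes it `C¹`.

The backstepping transform `w = u - ∫₀ˣ k u` formally turns the closed loop into `w_t = w_x` with
`w(1,t) = W(t)`, where `W(t)` is the integral of `(khat - k)(1,y)` against `u(y,t)`. For weak
solutions this is proved by duality: the test function is `e^{st}` times the adjoint transform of
`e^{sx}`, and the kernel equations cancel everything except the boundary terms
(`CharacteristicKernel.weak_integrand`). What remains for each `s` is an equality of exponential
moments: the outlet trace on `(0,T)` followed by `w(T)` has the same moments as `w(0)` followed by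
`W`. Moments at integer `s` determine an integrable function, by Weierstrass approximation in `e^z`.
Hence `w(T)` is the window `[T, T+1]` of one signal `q`, namely `w(0)` followed by `W`.

Stability is then a delay inequality. The transform is bounded above and below in `L²` with
constants depending on `κ`, so for small `ε` one has `W(t)² ≤ ‖w(t)‖²/4`: each value of `q` after
time 1 is controlled by the preceding unit window. Window energies therefore at least halve per unit
of time (`decay_of_window_bound`), and the lower bound on the transform returns the decay to `u`. -/

/-! ### Differentiation of parameter integrals. -/

theorem hasFDerivAt_of_continuous_partials {m mx my : ℝ × ℝ → ℝ} (hmx : Continuous mx)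
    (hmy : Continuous my) (hx : ∀ x y, HasDerivAt (fun x => m (x, y)) (mx (x, y)) x)
    (hy : ∀ x y, HasDerivAt (fun y => m (x, y)) (my (x, y)) y) (p : ℝ × ℝ) :
    HasFDerivAt m (mx p • ContinuousLinearMap.fst ℝ ℝ ℝ
      + my p • ContinuousLinearMap.snd ℝ ℝ ℝ) p := by
  have h := hasStrictFDerivAt_uncurry_coprod (𝕜 := ℝ) (u := p) (f := fun x y => m (x, y))
    (f₁ := fun x y => ContinuousLinearMap.toSpanSingleton ℝ (mx (x, y)))
    (f₂ := fun x y => ContinuousLinearMap.toSpanSingleton ℝ (my (x, y)))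
    (Filter.Eventually.of_forall fun v => (hx v.1 v.2).hasFDerivAt)
    (Filter.Eventually.of_forall fun v => (hy v.1 v.2).hasFDerivAt)
    (by
      apply Continuous.continuousAt
      change Continuous fun q : ℝ × ℝ => ContinuousLinearMap.toSpanSingletonCLE (𝕜 := ℝ) (mx q)
      fun_prop)
    (by
      apply Continuous.continuousAt
      change Continuous fun q : ℝ × ℝ => ContinuousLinearMap.toSpanSingletonCLE (𝕜 := ℝ) (my q)
      fun_prop)
  refine h.hasFDerivAt.congr_fderiv ?_
  ext <;> simp [Function.HasUncurry.uncurry]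

theorem contDiff_one_of_continuous_partials {m mx my : ℝ × ℝ → ℝ} (hmx : Continuous mx)
    (hmy : Continuous my) (hx : ∀ x y, HasDerivAt (fun x => m (x, y)) (mx (x, y)) x)
    (hy : ∀ x y, HasDerivAt (fun y => m (x, y)) (my (x, y)) y) : ContDiff ℝ 1 m := by
  refine contDiff_one_iff_hasFDerivAt.2 ⟨fun p => mx p • ContinuousLinearMap.fst ℝ ℝ ℝ
      + my p • ContinuousLinearMap.snd ℝ ℝ ℝ, by fun_prop,
      hasFDerivAt_of_continuous_partials hmx hmy hx hy⟩

theorem hasDerivAt_integral_of_continuous_deriv {m m' : ℝ × ℝ → ℝ} (hm : Continuous m)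
    (hm' : Continuous m') (hd : ∀ x s, HasDerivAt (fun x => m (x, s)) (m' (x, s)) x)
    (a b x : ℝ) :
    HasDerivAt (fun x => ∫ s in a..b, m (x, s)) (∫ s in a..b, m' (x, s)) x := by
  obtain ⟨C, hC⟩ := ((isCompact_closedBall x 1).prod
    (isCompact_uIcc (a := a) (b := b))).exists_bound_of_continuousOn
    hm'.continuousOn
  refine (intervalIntegral.hasDerivAt_integral_of_dominated_loc_of_deriv_le
    (F := fun x s => m (x, s)) (F' := fun x s => m' (x, s)) (bound := fun _ => C)
    (Metric.closedBall_mem_nhds x one_pos) ?_ ?_ ?_ ?_ ?_ ?_).2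
  · exact Filter.Eventually.of_forall fun y =>
      (by fun_prop : Continuous fun s => m (y, s)).aestronglyMeasurable
  · exact (by fun_prop : Continuous fun s => m (x, s)).intervalIntegrable _ _
  · exact (by fun_prop : Continuous fun s => m' (x, s)).aestronglyMeasurable
  · exact Filter.Eventually.of_forall fun t ht y hy => hC (y, t) ⟨hy, uIoc_subset_uIcc ht⟩
  · exact intervalIntegrable_const
  · exact Filter.Eventually.of_forall fun t _ y _ => hd y t

theorem hasDerivAt_primitive {c : ℝ → ℝ} (hc : Continuous c) (a x : ℝ) :
    HasDerivAt (fun x => ∫ s in a..x, c s) (c x) x :=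
  intervalIntegral.integral_hasDerivAt_right (hc.intervalIntegrable _ _)
    hc.stronglyMeasurable.stronglyMeasurableAtFilter hc.continuousAt

/-- The Leibniz rule for an integral with a variable upper limit. -/
theorem hasDerivAt_integral_variable_limit {m m' : ℝ × ℝ → ℝ} (hm : Continuous m)
    (hm' : Continuous m') (hd : ∀ x s, HasDerivAt (fun x => m (x, s)) (m' (x, s)) x)
    {b : ℝ → ℝ} {b' x : ℝ} (hb : HasDerivAt b b' x) :
    HasDerivAt (fun x => ∫ s in (0 : ℝ)..b x, m (x, s))
      ((∫ s in (0 : ℝ)..b x, m' (x, s)) + m (x, b x) * b') x := by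
  have h := hasFDerivAt_of_continuous_partials (m := fun p => ∫ s in (0 : ℝ)..p.2, m (p.1, s))
    (mx := fun p => ∫ s in (0 : ℝ)..p.2, m' (p.1, s)) (my := m) (by fun_prop) hm
    (fun x y => hasDerivAt_integral_of_continuous_deriv hm hm' hd 0 y x)
    (fun x y => hasDerivAt_primitive (by fun_prop : Continuous fun s => m (x, s)) 0 y) (x, b x)
  have := h.comp_hasDerivAt x ((hasDerivAt_id x).prodMk hb)
  simpa using! this

/-! ### The kernel operator in characteristic coordinates and its smoothing effect. -/

/-- The linear part of the kernel equation in the coordinates `(x - y, y)`. -/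
noncomputable def kernelLin (g : ℝ → ℝ) (F K : ℝ × ℝ → ℝ) (p : ℝ × ℝ) : ℝ :=
  (∫ s in (0 : ℝ)..p.1, g (p.1 - s) * K (s, p.1 - s))
    + ∫ η in (0 : ℝ)..p.2, ∫ s in (0 : ℝ)..p.1, F (p.1 - s, η) * K (s, p.1 - s + η)

/-- The source term of the kernel equation in the coordinates `(x - y, y)`. -/
noncomputable def kernelSource (g : ℝ → ℝ) (F : ℝ × ℝ → ℝ) (p : ℝ × ℝ) : ℝ :=
  -g p.1 - ∫ η in (0 : ℝ)..p.2, F (p.1, η)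

/-- The right-hand side of the kernel equation in the coordinates `(x - y, y)`. -/
noncomputable def kernelOp (g : ℝ → ℝ) (F K : ℝ × ℝ → ℝ) (p : ℝ × ℝ) : ℝ :=
  kernelSource g F p + kernelLin g F K p

/-- The derivative of `kernelOp g F K` in the second variable. -/
noncomputable def kernelOpSnd (F K : ℝ × ℝ → ℝ) (p : ℝ × ℝ) : ℝ :=
  -F p + ∫ s in (0 : ℝ)..p.1, F (p.1 - s, p.2) * K (s, p.1 - s + p.2)

section

variable {g : ℝ → ℝ} {F K : ℝ × ℝ → ℝ}

theorem continuous_kernelSource (hg : Continuous g) (hF : Continuous F) :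
    Continuous (kernelSource g F) := by
  unfold kernelSource
  fun_prop

theorem continuous_kernelLin (hg : Continuous g) (hF : Continuous F) (hK : Continuous K) :
    Continuous (kernelLin g F K) := by
  unfold kernelLin
  fun_prop

theorem continuous_kernelOp (hg : Continuous g) (hF : Continuous F) (hK : Continuous K) :
    Continuous (kernelOp g F K) :=
  (continuous_kernelSource hg hF).add (continuous_kernelLin hg hF hK)

theorem continuous_kernelOpSnd (hF : Continuous F) (hK : Continuous K) :
    Continuous (kernelOpSnd F K) := by
  unfold kernelOpSnd
  fun_prop

/-- The second variable occurs only as an upper limit of integration, so continuity of `F` and `K`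
already gives this derivative. -/
theorem hasDerivAt_kernelOp_snd (hF : Continuous F) (hK : Continuous K) (z y : ℝ) :
    HasDerivAt (fun y => kernelOp g F K (z, y)) (kernelOpSnd F K (z, y)) y := by
  have h1 := hasDerivAt_primitive (by fun_prop : Continuous fun η => F (z, η)) 0 y
  have h2 := hasDerivAt_primitive (by fun_prop : Continuous fun η =>
    ∫ s in (0 : ℝ)..z, F (z - s, η) * K (s, z - s + η)) 0 y
  exact (h1.const_sub (-g z)).add (h2.const_add (∫ s in (0 : ℝ)..z, g (z - s) * K (s, z - s)))

/-- Since `s` is the integration variable, `z` enters `K (s, z - s + η)` through the second slot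
only. Differentiating in `z` therefore needs `Ky` but no derivative of `K` in its first variable,
and of `F` only the derivative `Fz`. -/
theorem contDiff_kernelOp {g' : ℝ → ℝ} {Fz Ky : ℝ × ℝ → ℝ} (hg' : Continuous g')
    (hgd : ∀ z, HasDerivAt g (g' z) z) (hF : Continuous F) (hFz : Continuous Fz)
    (hFd : ∀ z y, HasDerivAt (fun z => F (z, y)) (Fz (z, y)) z) (hK : Continuous K)
    (hKy : Continuous Ky) (hKd : ∀ z y, HasDerivAt (fun y => K (z, y)) (Ky (z, y)) y) :
    ContDiff ℝ 1 (kernelOp g F K) := by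
  have hg : Continuous g := continuous_iff_continuousAt.2 fun z => (hgd z).continuousAt
  have hin : ∀ η s z : ℝ, HasDerivAt (fun z => F (z - s, η) * K (s, z - s + η))
      (Fz (z - s, η) * K (s, z - s + η) + F (z - s, η) * Ky (s, z - s + η)) z := by
    intro η s z
    have e := (hasDerivAt_id z).sub_const s
    have h1 := (hFd (z - s) η).comp z e
    have h2 := (hKd s (z - s + η)).comp z (e.add_const η)
    simpa using! h1.mul h2
  let inner : ℝ × ℝ → ℝ := fun p => ∫ s in (0 : ℝ)..p.1, F (p.1 - s, p.2) * K (s, p.1 - s + p.2)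
  let inner' : ℝ × ℝ → ℝ := fun p =>
    (∫ s in (0 : ℝ)..p.1, (Fz (p.1 - s, p.2) * K (s, p.1 - s + p.2)
      + F (p.1 - s, p.2) * Ky (s, p.1 - s + p.2)))
      + F (p.1 - p.1, p.2) * K (p.1, p.1 - p.1 + p.2) * 1
  have hinner : ∀ z η, HasDerivAt (fun z => inner (z, η)) (inner' (z, η)) z := fun z η =>
    hasDerivAt_integral_variable_limit
      (m := fun p => F (p.1 - p.2, η) * K (p.2, p.1 - p.2 + η))
      (m' := fun p => Fz (p.1 - p.2, η) * K (p.2, p.1 - p.2 + η)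
        + F (p.1 - p.2, η) * Ky (p.2, p.1 - p.2 + η)) (by fun_prop) (by fun_prop)
      (fun x s => hin η s x) (hasDerivAt_id z)
  have hbdry : ∀ z, HasDerivAt (fun z => ∫ s in (0 : ℝ)..z, g (z - s) * K (s, z - s))
      ((∫ s in (0 : ℝ)..z, (g' (z - s) * K (s, z - s) + g (z - s) * Ky (s, z - s)))
        + g (z - z) * K (z, z - z) * 1) z := by
    intro z
    refine hasDerivAt_integral_variable_limit
      (m := fun p => g (p.1 - p.2) * K (p.2, p.1 - p.2))
      (m' := fun p => g' (p.1 - p.2) * K (p.2, p.1 - p.2)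
        + g (p.1 - p.2) * Ky (p.2, p.1 - p.2)) (by fun_prop) (by fun_prop) ?_ (hasDerivAt_id z)
    intro x s
    have e := (hasDerivAt_id x).sub_const s
    simpa using! ((hgd (x - s)).comp x e).mul ((hKd s (x - s)).comp x e)
  refine contDiff_one_of_continuous_partials
    (mx := fun p => (-g' p.1 - ∫ η in (0 : ℝ)..p.2, Fz (p.1, η)) +
      (((∫ s in (0 : ℝ)..p.1, (g' (p.1 - s) * K (s, p.1 - s) + g (p.1 - s) * Ky (s, p.1 - s)))
        + g (p.1 - p.1) * K (p.1, p.1 - p.1) * 1) + ∫ η in (0 : ℝ)..p.2, inner' (p.1, η)))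
    (by fun_prop) (continuous_kernelOpSnd hF hK) (fun z y => ?_)
    (fun z y => hasDerivAt_kernelOp_snd hF hK z y)
  refine (((hgd z).neg).sub (hasDerivAt_integral_of_continuous_deriv hF hFz hFd 0 y z)).add
    ((hbdry z).add (hasDerivAt_integral_of_continuous_deriv (m := inner) (m' := inner')
      (by fun_prop) (by fun_prop) hinner 0 y z))

/-! ### The simplex and the estimates for the kernel operator on it. -/

/-- The triangle in the coordinates `(x - y, y)`. -/
def cornerSimplex : Set (ℝ × ℝ) := {p | 0 ≤ p.1 ∧ 0 ≤ p.2 ∧ p.1 + p.2 ≤ 1}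

/-- A continuous retraction of the plane onto `cornerSimplex`. -/
noncomputable def simplexRetraction (p : ℝ × ℝ) : ℝ × ℝ :=
  (max 0 (min p.1 (1 - max 0 (min p.2 1))), max 0 (min p.2 1))

theorem continuous_simplexRetraction : Continuous simplexRetraction := by
  unfold simplexRetraction
  fun_prop

theorem simplexRetraction_mem (p : ℝ × ℝ) : simplexRetraction p ∈ cornerSimplex := by
  have h1 : max 0 (min p.2 1) ≤ 1 := max_le zero_le_one (min_le_right _ _)
  refine ⟨le_max_left _ _, le_max_left _ _, ?_⟩
  have : max 0 (min p.1 (1 - max 0 (min p.2 1))) ≤ 1 - max 0 (min p.2 1) :=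
    max_le (by linarith) (min_le_right _ _)
  simp only [simplexRetraction]
  linarith

theorem simplexRetraction_of_mem {p : ℝ × ℝ} (hp : p ∈ cornerSimplex) :
    simplexRetraction p = p := by
  obtain ⟨h1, h2, h3⟩ := hp
  have e2 : max 0 (min p.2 1) = p.2 := by rw [min_eq_left (by linarith), max_eq_right h2]
  have e1 : max 0 (min p.1 (1 - p.2)) = p.1 := by
    rw [min_eq_left (by linarith), max_eq_right h1]
  simp only [simplexRetraction, e2, e1]

theorem isCompact_cornerSimplex : IsCompact cornerSimplex := by
  have : cornerSimplex = simplexRetraction '' (Icc 0 1 ×ˢ Icc 0 1) := by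
    ext p
    constructor
    · intro hp
      refine ⟨p, ?_, simplexRetraction_of_mem hp⟩
      obtain ⟨h1, h2, h3⟩ := hp
      exact ⟨⟨h1, by linarith⟩, ⟨h2, by linarith⟩⟩
    · rintro ⟨q, -, rfl⟩
      exact simplexRetraction_mem q
  rw [this]
  exact (isCompact_Icc.prod isCompact_Icc).image continuous_simplexRetraction

/-- Domain of dependence: at a point of the simplex, the operator samples `K` only at points of the
simplex. Values of an extension to the plane are thus irrelevant. -/
theorem kernelLin_congr {K' : ℝ × ℝ → ℝ} (h : EqOn K K' cornerSimplex) {p : ℝ × ℝ}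
    (hp : p ∈ cornerSimplex) : kernelLin g F K p = kernelLin g F K' p := by
  obtain ⟨h1, h2, h3⟩ := hp
  unfold kernelLin
  congr 1
  · refine intervalIntegral.integral_congr fun s hs => ?_
    rw [uIcc_of_le h1] at hs
    rw [h ⟨hs.1, sub_nonneg.2 hs.2, by simp only; linarith⟩]
  · refine intervalIntegral.integral_congr fun η hη => intervalIntegral.integral_congr fun s hs => ?_
    rw [uIcc_of_le h1] at hs
    rw [uIcc_of_le h2] at hη
    rw [h ⟨hs.1, by simp only; linarith [hs.2, hη.1], by simp only; linarith [hη.2]⟩]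

theorem kernelOp_congr {K' : ℝ × ℝ → ℝ} (h : EqOn K K' cornerSimplex) {p : ℝ × ℝ}
    (hp : p ∈ cornerSimplex) : kernelOp g F K p = kernelOp g F K' p :=
  congrArg (kernelSource g F p + ·) (kernelLin_congr h hp)

theorem kernelLin_sub {K' : ℝ × ℝ → ℝ} (hg : Continuous g) (hF : Continuous F)
    (hK : Continuous K) (hK' : Continuous K') (p : ℝ × ℝ) :
    kernelLin g F K p - kernelLin g F K' p = kernelLin g F (fun q => K q - K' q) p := by
  unfold kernelLin
  have h1 : ∀ η : ℝ, ∫ s in (0 : ℝ)..p.1, F (p.1 - s, η) * (K (s, p.1 - s + η)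
      - K' (s, p.1 - s + η)) = (∫ s in (0 : ℝ)..p.1, F (p.1 - s, η) * K (s, p.1 - s + η))
      - ∫ s in (0 : ℝ)..p.1, F (p.1 - s, η) * K' (s, p.1 - s + η) := by
    intro η
    rw [← intervalIntegral.integral_sub]
    · simp only [mul_sub]
    · exact Continuous.intervalIntegrable (by fun_prop) _ _
    · exact Continuous.intervalIntegrable (by fun_prop) _ _
  simp only [h1]
  rw [intervalIntegral.integral_sub, add_sub_add_comm, ← intervalIntegral.integral_sub]
  · simp only [mul_sub]
  all_goals exact Continuous.intervalIntegrable (by fun_prop) _ _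

theorem abs_kernelSource_le {Bg Bf : ℝ} (hBg : ∀ z ∈ Icc (0 : ℝ) 1, |g z| ≤ Bg)
    (hBf : ∀ q ∈ cornerSimplex, |F q| ≤ Bf) (hBf0 : 0 ≤ Bf) {p : ℝ × ℝ} (hp : p ∈ cornerSimplex) :
    |kernelSource g F p| ≤ Bg + Bf := by
  obtain ⟨h1, h2, h3⟩ := hp
  have a1 := hBg p.1 ⟨h1, by linarith⟩
  have a2 : ‖∫ η in (0 : ℝ)..p.2, F (p.1, η)‖ ≤ Bf * |p.2 - 0| := by
    refine intervalIntegral.norm_integral_le_of_norm_le_const fun η hη => ?_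
    rw [uIoc_of_le h2] at hη
    exact hBf _ ⟨h1, hη.1.le, by simp only; linarith [hη.2]⟩
  rw [Real.norm_eq_abs, sub_zero, abs_of_nonneg h2] at a2
  have a3 : Bf * p.2 ≤ Bf := mul_le_of_le_one_right hBf0 (by linarith)
  unfold kernelSource
  calc _ ≤ |-g p.1| + |∫ η in (0 : ℝ)..p.2, F (p.1, η)| := abs_sub _ _
    _ ≤ _ := by rw [abs_neg]; linarith

theorem abs_integral_le_of_abs_le_exp {c : ℝ → ℝ} {C lam z : ℝ} (hlam : 0 < lam) (hC : 0 ≤ C)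
    (hz : 0 ≤ z) (h : ∀ s ∈ Icc 0 z, |c s| ≤ C * Real.exp (lam * s)) :
    |∫ s in (0 : ℝ)..z, c s| ≤ C / lam * Real.exp (lam * z) := by
  have h1 : ‖∫ s in (0 : ℝ)..z, c s‖ ≤ ∫ s in (0 : ℝ)..z, C * Real.exp (lam * s) :=
    intervalIntegral.norm_integral_le_of_norm_le hz
      (Filter.Eventually.of_forall fun s hs => h s ⟨hs.1.le, hs.2⟩)
      (Continuous.intervalIntegrable (by fun_prop) _ _)
  have h2 : ∫ s in (0 : ℝ)..z, C * Real.exp (lam * s)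
      = C / lam * Real.exp (lam * z) - C / lam * Real.exp (lam * 0) := by
    refine intervalIntegral.integral_eq_sub_of_hasDerivAt
      (f := fun s => C / lam * Real.exp (lam * s)) (fun s _ => ?_)
      (Continuous.intervalIntegrable (by fun_prop) _ _)
    have h3 := ((((hasDerivAt_id s).const_mul lam).exp).const_mul (C / lam))
    have h4 : C * Real.exp (lam * s) = C / lam * (Real.exp (lam * s) * (lam * 1)) := by
      field_simp
    rw [h4]
    exact h3
  rw [Real.norm_eq_abs, h2] at h1
  have : 0 ≤ C / lam * Real.exp (lam * 0) := by positivity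
  linarith

/-- Integrating the weight `exp (lam * s)` up to `p.1` gains a factor `1 / lam`, and the outer
integral has length at most 1. The operator norm for the weight is at most `(Bg + Bf) / lam ≤ 1 /
2`. -/
theorem abs_kernelLin_le {Bg Bf lam N : ℝ} (hBg : ∀ z ∈ Icc (0 : ℝ) 1, |g z| ≤ Bg)
    (hBf : ∀ q ∈ cornerSimplex, |F q| ≤ Bf) (hBg0 : 0 ≤ Bg) (hBf0 : 0 ≤ Bf) (hlam : 0 < lam)
    (hlam' : 2 * (Bg + Bf) ≤ lam) (hN : 0 ≤ N)
    (hK : ∀ q ∈ cornerSimplex, |K q| ≤ N * Real.exp (lam * q.1)) {p : ℝ × ℝ}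
    (hp : p ∈ cornerSimplex) :
    |kernelLin g F K p| ≤ N / 2 * Real.exp (lam * p.1) := by
  obtain ⟨h1, h2, h3⟩ := hp
  have a1 : |∫ s in (0 : ℝ)..p.1, g (p.1 - s) * K (s, p.1 - s)|
      ≤ Bg * N / lam * Real.exp (lam * p.1) := by
    refine abs_integral_le_of_abs_le_exp hlam (by positivity) h1 fun s hs => ?_
    rw [abs_mul, mul_assoc]
    exact mul_le_mul (hBg _ ⟨by linarith [hs.2], by linarith [hs.1]⟩)
      (hK _ ⟨hs.1, by simp only; linarith [hs.2], by simp only; linarith⟩) (abs_nonneg _) hBg0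
  have a2 : ‖∫ η in (0 : ℝ)..p.2, ∫ s in (0 : ℝ)..p.1, F (p.1 - s, η) * K (s, p.1 - s + η)‖
      ≤ Bf * N / lam * Real.exp (lam * p.1) * |p.2 - 0| := by
    refine intervalIntegral.norm_integral_le_of_norm_le_const fun η hη => ?_
    rw [uIoc_of_le h2] at hη
    refine abs_integral_le_of_abs_le_exp hlam (by positivity) h1 fun s hs => ?_
    rw [abs_mul, mul_assoc]
    exact mul_le_mul (hBf _ ⟨by simp only; linarith [hs.2], hη.1.le,
        by simp only; linarith [hs.1, hη.2]⟩)
      (hK _ ⟨hs.1, by simp only; linarith [hs.2, hη.1], by simp only; linarith [hη.2]⟩)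
      (abs_nonneg _) hBf0
  rw [Real.norm_eq_abs, sub_zero, abs_of_nonneg h2] at a2
  have a3 : Bf * N / lam * Real.exp (lam * p.1) * p.2 ≤ Bf * N / lam * Real.exp (lam * p.1) :=
    mul_le_of_le_one_right (by positivity) (by linarith)
  have a4 : (Bg + Bf) / lam ≤ 1 / 2 := by
    rw [div_le_div_iff₀ hlam two_pos]
    linarith
  calc |kernelLin g F K p| ≤ _ + _ := abs_add_le _ _
    _ ≤ Bg * N / lam * Real.exp (lam * p.1) + Bf * N / lam * Real.exp (lam * p.1) :=
      add_le_add a1 (a2.trans a3)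
    _ = (Bg + Bf) / lam * (N * Real.exp (lam * p.1)) := by ring
    _ ≤ 1 / 2 * (N * Real.exp (lam * p.1)) := by gcongr
    _ = _ := by ring

end

/-! ### Banach's fixed-point theorem in a weighted sup norm. -/

instance : CompactSpace cornerSimplex := isCompact_iff_compactSpace.1 isCompact_cornerSimplex

/-- The kernel with exponentially weighted restriction `H` to the simplex. -/
noncomputable def weightedExtension (lam : ℝ) (H : C(cornerSimplex, ℝ)) (q : ℝ × ℝ) : ℝ :=
  Real.exp (lam * (simplexRetraction q).1) * H ⟨simplexRetraction q, simplexRetraction_mem q⟩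

/-- The exponentially weighted restriction to the simplex of a continuous function. -/
noncomputable def weightedRestriction (lam : ℝ) {K : ℝ × ℝ → ℝ} (hK : ContinuousOn K cornerSimplex) :
    C(cornerSimplex, ℝ) :=
  ⟨fun p => Real.exp (-(lam * p.1.1)) * K p.1,
    (by fun_prop : Continuous fun p : cornerSimplex => Real.exp (-(lam * p.1.1))).mul
      hK.domRestrict⟩

section

variable {g : ℝ → ℝ} {F : ℝ × ℝ → ℝ} {lam : ℝ}

theorem continuous_weightedExtension (H : C(cornerSimplex, ℝ)) :
    Continuous (weightedExtension lam H) := by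
  have := continuous_simplexRetraction
  unfold weightedExtension
  fun_prop

theorem weightedExtension_of_mem (H : C(cornerSimplex, ℝ)) {q : ℝ × ℝ} (hq : q ∈ cornerSimplex) :
    weightedExtension lam H q = Real.exp (lam * q.1) * H ⟨q, hq⟩ := by
  simp only [weightedExtension, simplexRetraction_of_mem hq]

theorem weightedExtension_weightedRestriction {K : ℝ × ℝ → ℝ}
    (hK : ContinuousOn K cornerSimplex) :
    EqOn (weightedExtension lam (weightedRestriction lam hK)) K cornerSimplex := by
  intro q hq
  rw [weightedExtension_of_mem _ hq]
  simp only [weightedRestriction, ContinuousMap.coe_mk]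
  rw [← mul_assoc, ← Real.exp_add, add_neg_cancel, Real.exp_zero, one_mul]

theorem abs_weightedExtension_le (H : C(cornerSimplex, ℝ)) {q : ℝ × ℝ} (hq : q ∈ cornerSimplex) :
    |weightedExtension lam H q| ≤ ‖H‖ * Real.exp (lam * q.1) := by
  rw [weightedExtension_of_mem _ hq, abs_mul, Real.abs_exp, mul_comm]
  exact mul_le_mul_of_nonneg_right (H.norm_coe_le_norm _) (Real.exp_pos _).le

/-- The weighted kernel operator on `C(cornerSimplex, ℝ)`. -/
noncomputable def weightedKernelOp (lam : ℝ) (hg : Continuous g) (hF : Continuous F)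
    (H : C(cornerSimplex, ℝ)) : C(cornerSimplex, ℝ) :=
  weightedRestriction lam
    (continuous_kernelOp hg hF (continuous_weightedExtension (lam := lam) H)).continuousOn

theorem exists_continuous_kernel {Bg Bf : ℝ} (hg : Continuous g) (hF : Continuous F)
    (hBg : ∀ z ∈ Icc (0 : ℝ) 1, |g z| ≤ Bg) (hBf : ∀ q ∈ cornerSimplex, |F q| ≤ Bf)
    (hBg0 : 0 < Bg) (hBf0 : 0 < Bf) :
    ∃ K : ℝ × ℝ → ℝ, Continuous K ∧ EqOn K (kernelOp g F K) cornerSimplex ∧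
      (∀ p ∈ cornerSimplex, |K p| ≤ 2 * (Bg + Bf) * Real.exp (2 * (Bg + Bf))) ∧
      ∀ K' : ℝ × ℝ → ℝ, ContinuousOn K' cornerSimplex → EqOn K' (kernelOp g F K') cornerSimplex →
        EqOn K' K cornerSimplex := by
  -- The smallest rate for which `abs_kernelLin_le` yields the contraction ratio 1/2.
  set lam := 2 * (Bg + Bf) with hlam
  have hlam0 : 0 < lam := by positivity
  let T := weightedKernelOp lam hg hF
  have hT : ContractingWith (1 / 2) T := by
    refine ⟨by rw [← NNReal.coe_lt_coe]; norm_num, LipschitzWith.of_dist_le_mul fun H₁ H₂ => ?_⟩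
    have hnn : (0 : ℝ) ≤ ((1 / 2 : NNReal) : ℝ) * dist H₁ H₂ := by positivity
    rw [ContinuousMap.dist_le hnn]
    intro p
    have h1 : T H₁ p - T H₂ p = Real.exp (-(lam * p.1.1)) *
        kernelLin g F (fun q => weightedExtension lam H₁ q - weightedExtension lam H₂ q) p.1 := by
      rw [← kernelLin_sub hg hF (continuous_weightedExtension H₁) (continuous_weightedExtension H₂)]
      simp only [T, weightedKernelOp, weightedRestriction, ContinuousMap.coe_mk, kernelOp]
      ring
    have h2 := abs_kernelLin_le (N := dist H₁ H₂) hBg hBf hBg0.le hBf0.le hlam0 hlam.ge dist_nonneg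
      (K := fun q => weightedExtension lam H₁ q - weightedExtension lam H₂ q) (fun q hq => by
        rw [weightedExtension_of_mem _ hq, weightedExtension_of_mem _ hq, ← mul_sub, abs_mul,
          Real.abs_exp, mul_comm]
        gcongr
        exact ContinuousMap.dist_apply_le_dist (f := H₁) (g := H₂) _) p.2
    rw [Real.dist_eq, h1, abs_mul, Real.abs_exp]
    calc _ ≤ Real.exp (-(lam * p.1.1)) * (dist H₁ H₂ / 2 * Real.exp (lam * p.1.1)) := by gcongr
      _ = dist H₁ H₂ / 2 * (Real.exp (-(lam * p.1.1)) * Real.exp (lam * p.1.1)) := by ring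
      _ = _ := by
        rw [← Real.exp_add, neg_add_cancel, Real.exp_zero]
        push_cast
        ring
  have hfix : ∀ H : C(cornerSimplex, ℝ), T H = H →
      EqOn (weightedExtension lam H) (kernelOp g F (weightedExtension lam H)) cornerSimplex := by
    intro H hH q hq
    have := weightedExtension_weightedRestriction (lam := lam) (continuous_kernelOp hg hF
      (continuous_weightedExtension (lam := lam) H)).continuousOn hq
    rw [← this]
    exact congrFun (congrArg (weightedExtension lam) hH.symm) q
  let H := ContractingWith.fixedPoint T hT
  have hH : T H = H := hT.fixedPoint_isFixedPt
  refine ⟨weightedExtension lam H, continuous_weightedExtension H, hfix H hH, ?_, ?_⟩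
  · have hle : ∀ q ∈ cornerSimplex, |weightedExtension lam H q|
        ≤ (Bg + Bf + ‖H‖ / 2) * Real.exp (lam * q.1) := by
      intro q hq
      have e0 : (1 : ℝ) ≤ Real.exp (lam * q.1) := Real.one_le_exp (mul_nonneg hlam0.le hq.1)
      have e1 := abs_kernelSource_le hBg hBf hBf0.le hq
      have e2 := abs_kernelLin_le (N := ‖H‖) hBg hBf hBg0.le hBf0.le hlam0 hlam.ge
        (norm_nonneg _) (fun q hq => abs_weightedExtension_le H hq) hq
      rw [hfix H hH hq]
      calc _ ≤ |kernelSource g F q| + |kernelLin g F (weightedExtension lam H) q| := abs_add_le _ _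
        _ ≤ (Bg + Bf) * 1 + ‖H‖ / 2 * Real.exp (lam * q.1) := by linarith
        _ ≤ (Bg + Bf) * Real.exp (lam * q.1) + ‖H‖ / 2 * Real.exp (lam * q.1) := by gcongr
        _ = _ := by ring
    -- The fixed-point equation bounds `‖H‖` by the source plus half of itself; absorbing gives `‖H‖
    -- ≤ 2 * (Bg + Bf)`.
    have hnorm : ‖H‖ ≤ Bg + Bf + ‖H‖ / 2 := by
      rw [ContinuousMap.norm_le _ (by positivity)]
      intro q
      have := hle q.1 q.2
      rw [weightedExtension_of_mem _ q.2, abs_mul, Real.abs_exp, mul_comm] at this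
      exact le_of_mul_le_mul_right this (Real.exp_pos _)
    intro q hq
    calc _ ≤ _ := abs_weightedExtension_le H hq
      _ ≤ _ := by
        gcongr
        · linarith
        · exact mul_le_of_le_one_right hlam0.le (by linarith [hq.2.1, hq.2.2])
  · intro K' hK' hK'eq q hq
    have e1 := weightedExtension_weightedRestriction (lam := lam) hK'
    have : T (weightedRestriction lam hK') = weightedRestriction lam hK' := by
      ext p
      simp only [T, weightedKernelOp, weightedRestriction, ContinuousMap.coe_mk]
      rw [hK'eq p.2]
      congr 1
      exact kernelOp_congr e1 p.2
    rw [← e1 hq, hT.fixedPoint_unique this]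

/-- Bootstrap: one application of the operator to the continuous fixed point gives a derivative in
the second variable, a second one gives `C¹`. Neither changes the function on the simplex, but the
iterate is smooth on the whole plane. -/
theorem exists_contDiff_kernel {g' : ℝ → ℝ} {Fz : ℝ × ℝ → ℝ} {Bg Bf : ℝ} (hg' : Continuous g')
    (hgd : ∀ z, HasDerivAt g (g' z) z) (hF : Continuous F) (hFz : Continuous Fz)
    (hFd : ∀ z y, HasDerivAt (fun z => F (z, y)) (Fz (z, y)) z)
    (hBg : ∀ z ∈ Icc (0 : ℝ) 1, |g z| ≤ Bg) (hBf : ∀ q ∈ cornerSimplex, |F q| ≤ Bf)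
    (hBg0 : 0 < Bg) (hBf0 : 0 < Bf) :
    ∃ K Ky : ℝ × ℝ → ℝ, ContDiff ℝ 1 K ∧ Continuous Ky ∧
      (∀ z y, HasDerivAt (fun y => K (z, y)) (Ky (z, y)) y) ∧
      EqOn Ky (kernelOpSnd F K) cornerSimplex ∧ EqOn K (kernelOp g F K) cornerSimplex ∧
      (∀ p ∈ cornerSimplex, |K p| ≤ 2 * (Bg + Bf) * Real.exp (2 * (Bg + Bf))) ∧
      ∀ K' : ℝ × ℝ → ℝ, ContinuousOn K' cornerSimplex → EqOn K' (kernelOp g F K') cornerSimplex →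
        EqOn K' K cornerSimplex := by
  have hg : Continuous g := continuous_iff_continuousAt.2 fun z => (hgd z).continuousAt
  obtain ⟨K, hK, hKeq, hKb, hKu⟩ := exists_continuous_kernel hg hF hBg hBf hBg0 hBf0
  have hK1 := continuous_kernelOp hg hF hK
  have h2 : EqOn (kernelOp g F (kernelOp g F K)) K cornerSimplex := fun p hp => by
    rw [hKeq hp, kernelOp_congr hKeq hp]
  refine ⟨kernelOp g F (kernelOp g F K), kernelOpSnd F (kernelOp g F K),
    contDiff_kernelOp hg' hgd hF hFz hFd hK1 (continuous_kernelOpSnd hF hK)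
      (hasDerivAt_kernelOp_snd hF hK), continuous_kernelOpSnd hF hK1,
    hasDerivAt_kernelOp_snd hF hK1, ?_, ?_, ?_, ?_⟩
  · intro p hp
    unfold kernelOpSnd
    congr 1
    refine intervalIntegral.integral_congr fun s hs => ?_
    rw [uIcc_of_le hp.1] at hs
    have hm : (s, p.1 - s + p.2) ∈ cornerSimplex :=
      ⟨hs.1, by simp only; linarith [hs.2, hp.2.1], by simp only; linarith [hp.2.2]⟩
    rw [h2 hm, hKeq hm]
  · intro p hp
    rw [h2 hp, hKeq hp]
    exact (kernelOp_congr h2 hp).symm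
  · intro p hp
    rw [h2 hp]
    exact hKb p hp
  · intro K' hK' hK'eq p hp
    rw [h2 hp, hKu K' hK' hK'eq hp]

end

/-! ### Extension of the data off their domains, and return to the triangle. -/

theorem convex_triangle : Convex ℝ triangle := by
  intro p hp q hq a b ha hb hab
  obtain ⟨h1, h2, h3⟩ := hp
  obtain ⟨h4, h5, h6⟩ := hq
  refine ⟨?_, ?_, ?_⟩ <;> simp only [Prod.fst_add, Prod.snd_add, Prod.smul_fst, Prod.smul_snd,
    smul_eq_mul]
  · positivity
  · gcongr
  · calc a * p.1 + b * q.1 ≤ a * 1 + b * 1 := by gcongr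
      _ = 1 := by linarith

theorem uniqueDiffOn_triangle : UniqueDiffOn ℝ triangle := by
  refine uniqueDiffOn_convex convex_triangle ⟨(2 / 3, 1 / 3), ?_⟩
  refine interior_maximal (s := triangle) (t := {p : ℝ × ℝ | 0 < p.2 ∧ p.2 < p.1 ∧ p.1 < 1})
    (fun p hp => ⟨hp.1.le, hp.2.1.le, hp.2.2.le⟩) ?_ (by norm_num)
  exact (isOpen_lt continuous_const continuous_snd).inter
    ((isOpen_lt continuous_snd continuous_fst).inter (isOpen_lt continuous_fst continuous_const))

theorem add_mem_triangle {q : ℝ × ℝ} (hq : q ∈ cornerSimplex) : (q.1 + q.2, q.2) ∈ triangle :=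
  ⟨hq.2.1, by simpa using hq.1, hq.2.2⟩

theorem sub_mem_cornerSimplex {x y : ℝ} (h : (x, y) ∈ triangle) : (x - y, y) ∈ cornerSimplex :=
  ⟨sub_nonneg.2 h.2.1, h.1, by simpa using h.2.2⟩

/-- Clamp the derivative to the interval and integrate it: this keeps a continuous derivative on the
whole line. -/
theorem ContDiffOn.exists_hasDerivAt_extension_Icc {g : ℝ → ℝ} (hg : ContDiffOn ℝ 1 g (Icc 0 1)) :
    ∃ G G' : ℝ → ℝ, Continuous G' ∧ (∀ z, HasDerivAt G (G' z) z) ∧ EqOn G g (Icc 0 1) := by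
  have hc : Continuous fun s : ℝ => derivWithin g (Icc 0 1) (max 0 (min s 1)) :=
    (hg.continuousOn_derivWithin (uniqueDiffOn_Icc one_pos) le_rfl).comp_continuous (by fun_prop)
      fun s => ⟨le_max_left _ _, max_le zero_le_one (min_le_right _ _)⟩
  refine ⟨fun z => g 0 + ∫ s in (0 : ℝ)..z, derivWithin g (Icc 0 1) (max 0 (min s 1)),
    _, hc, fun z => (hasDerivAt_primitive hc 0 z).const_add _, fun z hz => ?_⟩
  have h : ∫ s in (0 : ℝ)..z, derivWithin g (Icc 0 1) (max 0 (min s 1)) = g z - g 0 := by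
    refine intervalIntegral.integral_eq_sub_of_hasDerivAt_of_le hz.1
      (hg.continuousOn.mono (Icc_subset_Icc_right hz.2)) (fun s hs => ?_)
      (hc.intervalIntegrable _ _)
    have hs1 : s < 1 := hs.2.trans_le hz.2
    rw [min_eq_left hs1.le, max_eq_right hs.1.le]
    exact ((hg.differentiableOn one_ne_zero) s ⟨hs.1.le, hs1.le⟩).hasDerivWithinAt.hasDerivAt
      (Icc_mem_nhds hs.1 hs1)
  simp only [h]
  ring

/-- Along constant `y`, `F` is the integral of the retracted `partialX f`, started from the diagonal
value. The segment from `(0, y)` to a point `(z, y)` of the simplex stays inside it, so `F` agrees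
with `f` there. -/
theorem ContDiffOn.exists_hasDerivAt_extension_triangle {f : ℝ × ℝ → ℝ}
    (hf : ContDiffOn ℝ 1 f triangle) :
    ∃ F Fz : ℝ × ℝ → ℝ, Continuous F ∧ Continuous Fz ∧
      (∀ z y, HasDerivAt (fun z => F (z, y)) (Fz (z, y)) z) ∧
      ∀ p ∈ cornerSimplex, F p = f (p.1 + p.2, p.2) := by
  have hdc : ContinuousOn (fun p => partialX f p) triangle :=
    (hf.continuousOn_fderivWithin uniqueDiffOn_triangle le_rfl).clm_apply continuousOn_const
  have hr := continuous_simplexRetraction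
  let shear : ℝ × ℝ → ℝ × ℝ := fun q =>
    ((simplexRetraction q).1 + (simplexRetraction q).2, (simplexRetraction q).2)
  have hshear : Continuous shear := by fun_prop
  have hmem : ∀ q, shear q ∈ triangle := fun q => add_mem_triangle (simplexRetraction_mem q)
  obtain ⟨P, hP⟩ : ∃ P : ℝ × ℝ → ℝ, ∀ q, P q = partialX f (shear q) := ⟨_, fun _ => rfl⟩
  obtain ⟨Q, hQ⟩ : ∃ Q : ℝ × ℝ → ℝ, ∀ q, Q q = f (shear q) := ⟨_, fun _ => rfl⟩
  have hc : Continuous P :=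
    (hdc.comp_continuous hshear hmem).congr fun q => (hP q).symm
  have hc0 : Continuous Q :=
    (hf.continuousOn.comp_continuous hshear hmem).congr fun q => (hQ q).symm
  refine ⟨fun q => Q (0, q.2) + ∫ s in (0 : ℝ)..q.1, P (s, q.2), P, by fun_prop, hc,
    fun z y => ?_, fun p hp => ?_⟩
  · exact (hasDerivAt_primitive (by fun_prop : Continuous fun s => P (s, y)) 0 z).const_add
      (Q (0, y))
  · obtain ⟨z, y⟩ := p
    obtain ⟨h1, h2, h3⟩ := hp
    simp only at h1 h2 h3
    have hsh : ∀ s ∈ Icc 0 z, shear (s, y) = (s + y, y) := fun s hs => by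
      simp only [shear]
      rw [simplexRetraction_of_mem ⟨hs.1, h2, by simp only; linarith [hs.2]⟩]
    have hmaps : MapsTo (fun s : ℝ => (s + y, y)) (Icc 0 z) triangle := fun s hs =>
      add_mem_triangle (q := (s, y)) ⟨hs.1, h2, by simp only; linarith [hs.2]⟩
    have h : ∫ s in (0 : ℝ)..z, P (s, y) = f (z + y, y) - f (0 + y, y) := by
      refine intervalIntegral.integral_eq_sub_of_hasDerivAt_of_le (f := fun s => f (s + y, y)) h1
        (hf.continuousOn.comp (by fun_prop) hmaps) (fun s hs => ?_)
        (Continuous.intervalIntegrable (by fun_prop) _ _)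
      have hs' : s ∈ Icc 0 z := Ioo_subset_Icc_self hs
      rw [hP, hsh s hs']
      have hd := ((hf.differentiableOn one_ne_zero) (s + y, y) (hmaps hs')).hasFDerivWithinAt
      have hl : HasDerivWithinAt (fun s : ℝ => (s + y, y)) ((1 : ℝ), (0 : ℝ)) (Icc 0 z) s :=
        (((hasDerivAt_id s).add_const y).prodMk (hasDerivAt_const s y)).hasDerivWithinAt
      exact (hd.comp_hasDerivWithinAt s hl hmaps).hasDerivAt (Icc_mem_nhds hs.1 hs.2)
    simp only [h]
    rw [hQ, hsh 0 ⟨le_rfl, h1⟩]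
    ring

section

variable {g G : ℝ → ℝ} {f F : ℝ × ℝ → ℝ}

/-- The substitution `s = x - y - ξ` matches the integrals over `ξ`: the point `(x - y + η, ξ + η)`
has characteristic coordinates `(s, x - y - s + η)`. -/
theorem kernelOp_eq (hG : EqOn G g (Icc 0 1))
    (hF : ∀ p ∈ cornerSimplex, F p = f (p.1 + p.2, p.2)) (k : ℝ × ℝ → ℝ) {x y : ℝ}
    (h : (x, y) ∈ triangle) :
    kernelOp G F (fun q => k (q.1 + q.2, q.2)) (x - y, y) =
      (-g (x - y) - ∫ ξ in (0 : ℝ)..y, f (x - y + ξ, ξ))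
      + ((∫ ξ in (0 : ℝ)..(x - y), g ξ * k (x - y, ξ))
        + ∫ η in (0 : ℝ)..y, ∫ ξ in (0 : ℝ)..(x - y),
            f (ξ + η, η) * k (x - y + η, ξ + η)) := by
  have h1 : 0 ≤ x - y := sub_nonneg.2 h.2.1
  have h2 : 0 ≤ y := h.1
  have h3 : x ≤ 1 := h.2.2
  unfold kernelOp kernelSource kernelLin
  congr 1
  · simp only
    congr 1
    · rw [hG ⟨h1, by linarith⟩]
    · refine intervalIntegral.integral_congr fun η hη => ?_
      rw [uIcc_of_le h2] at hη
      exact hF (x - y, η) ⟨h1, hη.1, by simp only; linarith [hη.2]⟩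
  · congr 1
    · have := intervalIntegral.integral_comp_sub_left (a := 0) (b := x - y)
        (fun ξ => g ξ * k (x - y, ξ)) (x - y)
      rw [sub_self, sub_zero] at this
      rw [← this]
      refine intervalIntegral.integral_congr fun s hs => ?_
      rw [uIcc_of_le h1] at hs
      rw [hG ⟨by linarith [hs.2], by linarith [hs.1]⟩]
      change g (x - y - s) * k (s + (x - y - s), x - y - s) = _
      rw [add_sub_cancel]
    · refine intervalIntegral.integral_congr fun η hη => ?_
      rw [uIcc_of_le h2] at hη
      have := intervalIntegral.integral_comp_sub_left (a := 0) (b := x - y)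
        (fun ξ => f (ξ + η, η) * k (x - y + η, ξ + η)) (x - y)
      rw [sub_self, sub_zero] at this
      simp only
      rw [← this]
      refine intervalIntegral.integral_congr fun s hs => ?_
      rw [uIcc_of_le h1] at hs
      rw [hF (x - y - s, η) ⟨by simp only; linarith [hs.2], hη.1,
        by simp only; linarith [hs.1, hη.2]⟩]
      change f (x - y - s + η, η) * k (s + (x - y - s + η), x - y - s + η) = _
      rw [← add_assoc, add_sub_cancel]

theorem IsBacksteppingKernel.eqOn_kernelOp (hG : EqOn G g (Icc 0 1))
    (hF : ∀ p ∈ cornerSimplex, F p = f (p.1 + p.2, p.2)) {k : ℝ × ℝ → ℝ}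
    (hk : IsBacksteppingKernel g f k) :
    EqOn (fun q => k (q.1 + q.2, q.2)) (kernelOp G F fun q => k (q.1 + q.2, q.2))
      cornerSimplex := by
  intro q hq
  have h := hk.kernel_eq _ _ (add_mem_triangle hq)
  rw [← kernelOp_eq hG hF k (add_mem_triangle hq), add_sub_cancel_right] at h
  exact h

theorem isBacksteppingKernel_of_eqOn_kernelOp (hG : EqOn G g (Icc 0 1))
    (hF : ∀ p ∈ cornerSimplex, F p = f (p.1 + p.2, p.2)) {K : ℝ × ℝ → ℝ}
    (hK : ContDiff ℝ 1 K) (hKeq : EqOn K (kernelOp G F K) cornerSimplex) :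
    IsBacksteppingKernel g f fun p => K (p.1 - p.2, p.2) := by
  refine ⟨(hK.comp (by fun_prop : ContDiff ℝ 1 fun p : ℝ × ℝ => (p.1 - p.2, p.2))).contDiffOn,
    fun x y h => ?_⟩
  have h1 := kernelOp_eq hG hF (fun p => K (p.1 - p.2, p.2)) h
  simp only [add_sub_cancel_right] at h1 ⊢
  rw [← h1]
  exact hKeq (sub_mem_cornerSimplex h)

end

/-! ### Fubini on a triangle and `L²` bounds for the Volterra transform. -/

theorem memLp_two_Icc_iff_Ioc {v : ℝ → ℝ} {a b : ℝ} :
    MemLp v 2 (volume.restrict (Icc a b)) ↔ MemLp v 2 (volume.restrict (Ioc a b)) := by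
  rw [restrict_Ioc_eq_restrict_Icc]

theorem MeasureTheory.MemLp.intervalIntegrable_of_Icc {v : ℝ → ℝ} {a b : ℝ} (hab : a ≤ b)
    (hv : MemLp v 2 (volume.restrict (Icc a b))) : IntervalIntegrable v volume a b :=
  (intervalIntegrable_iff_integrableOn_Ioc_of_le hab).2
    ((memLp_two_Icc_iff_Ioc.1 hv).integrable one_le_two)

theorem MeasureTheory.MemLp.intervalIntegrable_sq_of_Icc {v : ℝ → ℝ} {a b : ℝ} (hab : a ≤ b)
    (hv : MemLp v 2 (volume.restrict (Icc a b))) :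
    IntervalIntegrable (fun x => v x ^ 2) volume a b :=
  (intervalIntegrable_iff_integrableOn_Ioc_of_le hab).2 (memLp_two_Icc_iff_Ioc.1 hv).integrable_sq

theorem integral_mul_sq_le {α : Type*} [MeasurableSpace α] {μ : Measure α} {c v : α → ℝ}
    (hc : MemLp c 2 μ) (hv : MemLp v 2 μ) :
    (∫ x, c x * v x ∂μ) ^ 2 ≤ (∫ x, c x ^ 2 ∂μ) * ∫ x, v x ^ 2 ∂μ := by
  have key : ∀ {a b : α → ℝ} (ha : MemLp a 2 μ) (hb : MemLp b 2 μ),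
      inner ℝ (ha.toLp a) (hb.toLp b) = ∫ x, b x * a x ∂μ := by
    intro a b ha hb
    rw [L2.inner_def]
    refine integral_congr_ae ?_
    filter_upwards [ha.coeFn_toLp, hb.coeFn_toLp] with x h1 h2
    rw [h1, h2]
    rfl
  have h := real_inner_mul_inner_self_le (hv.toLp v) (hc.toLp c)
  rw [key, key, key] at h
  simp only [← sq] at h
  linarith

theorem integral_mul_sq_le_of_abs_le {c v : ℝ → ℝ} {a b C : ℝ} (hab : a ≤ b) (hab1 : b - a ≤ 1)
    (hc : ContinuousOn c (Icc a b)) (hC : ∀ x ∈ Icc a b, |c x| ≤ C)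
    (hv : MemLp v 2 (volume.restrict (Icc a b))) :
    (∫ x in a..b, c x * v x) ^ 2 ≤ C ^ 2 * ∫ x in a..b, v x ^ 2 := by
  have hC0 : 0 ≤ C := (abs_nonneg _).trans (hC a ⟨le_rfl, hab⟩)
  have hcm : MemLp c 2 (volume.restrict (Icc a b)) :=
    MemLp.of_bound (hc.aestronglyMeasurable measurableSet_Icc) C
      (by filter_upwards [ae_restrict_mem measurableSet_Icc] with x hx using hC x hx)
  have h1 := integral_mul_sq_le (memLp_two_Icc_iff_Ioc.1 hcm) (memLp_two_Icc_iff_Ioc.1 hv)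
  simp only [← intervalIntegral.integral_of_le hab] at h1
  have h2 : ∫ x in a..b, c x ^ 2 ≤ C ^ 2 := by
    calc _ ≤ ∫ _ in a..b, C ^ 2 := by
          refine intervalIntegral.integral_mono_on hab (hcm.intervalIntegrable_sq_of_Icc hab)
            intervalIntegrable_const fun x hx => ?_
          rw [← sq_abs]
          gcongr
          exact hC x hx
      _ = (b - a) * C ^ 2 := by simp
      _ ≤ 1 * C ^ 2 := by gcongr
      _ = C ^ 2 := one_mul _
  exact h1.trans (mul_le_mul_of_nonneg_right h2
    (intervalIntegral.integral_nonneg hab fun x _ => sq_nonneg _))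

theorem integrable_indicator_triangle {m : ℝ × ℝ → ℝ} (hm : Continuous m) {v : ℝ → ℝ} {a b : ℝ}
    (hab : a ≤ b) (hv : IntervalIntegrable v volume a b) :
    Integrable (fun p : ℝ × ℝ => {q : ℝ × ℝ | q.2 ≤ q.1}.indicator (fun q => m q * v q.2) p)
      ((volume.restrict (Ioc a b)).prod (volume.restrict (Ioc a b))) := by
  refine Integrable.indicator ?_ (measurableSet_le measurable_snd measurable_fst)
  obtain ⟨C, hC⟩ := ((isCompact_Icc (a := a) (b := b)).prod
    (isCompact_Icc (a := a) (b := b))).exists_bound_of_continuousOn hm.continuousOn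
  have hv' := ((intervalIntegrable_iff_integrableOn_Ioc_of_le hab).1 hv).comp_snd
    (volume.restrict (Ioc a b))
  refine hv'.bdd_mul (c := C) hm.aestronglyMeasurable ?_
  rw [Measure.prod_restrict]
  filter_upwards [ae_restrict_mem (measurableSet_Ioc.prod measurableSet_Ioc)] with p hp
  exact hC p ⟨Ioc_subset_Icc_self hp.1, Ioc_subset_Icc_self hp.2⟩

theorem integral_indicator_triangle_left {m : ℝ × ℝ → ℝ} {v : ℝ → ℝ} {a b x : ℝ}
    (hx : x ∈ Ioc a b) :
    ∫ y in Ioc a b, {q : ℝ × ℝ | q.2 ≤ q.1}.indicator (fun q => m q * v q.2) (x, y)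
      = ∫ y in a..x, m (x, y) * v y := by
  have h : ∀ y, {q : ℝ × ℝ | q.2 ≤ q.1}.indicator (fun q => m q * v q.2) (x, y)
      = (Iic x).indicator (fun y => m (x, y) * v y) y := fun y => rfl
  simp only [h]
  rw [setIntegral_indicator measurableSet_Iic, Ioc_inter_Iic, min_eq_right hx.2,
    intervalIntegral.integral_of_le hx.1.le]

theorem integral_indicator_triangle_right {m : ℝ × ℝ → ℝ} {v : ℝ → ℝ} {a b y : ℝ}
    (hy : y ∈ Ioc a b) :
    ∫ x in Ioc a b, {q : ℝ × ℝ | q.2 ≤ q.1}.indicator (fun q => m q * v q.2) (x, y)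
      = (∫ x in y..b, m (x, y)) * v y := by
  have h : ∀ x, {q : ℝ × ℝ | q.2 ≤ q.1}.indicator (fun q => m q * v q.2) (x, y)
      = (Ici y).indicator (fun x => m (x, y) * v y) x := fun x => rfl
  have hs : Ioc a b ∩ Ici y = Icc y b := by
    ext x
    simp only [mem_inter_iff, mem_Ioc, mem_Ici, mem_Icc]
    exact ⟨fun h => ⟨h.2, h.1.2⟩, fun h => ⟨⟨hy.1.trans_le h.1, h.2⟩, h.1⟩⟩
  simp only [h]
  rw [setIntegral_indicator measurableSet_Ici, hs, integral_Icc_eq_integral_Ioc,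
    ← intervalIntegral.integral_of_le hy.2, intervalIntegral.integral_mul_const]

theorem intervalIntegrable_integral_triangle {m : ℝ × ℝ → ℝ} (hm : Continuous m) {v : ℝ → ℝ}
    {a b : ℝ} (hab : a ≤ b) (hv : IntervalIntegrable v volume a b) :
    IntervalIntegrable (fun x => ∫ y in a..x, m (x, y) * v y) volume a b := by
  rw [intervalIntegrable_iff_integrableOn_Ioc_of_le hab]
  refine (integrable_indicator_triangle hm hab hv).integral_prod_left.congr ?_
  filter_upwards [ae_restrict_mem measurableSet_Ioc] with x hx
  exact integral_indicator_triangle_left hx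

/-- Exchange of the order of integration over a triangle. -/
theorem integral_integral_triangle {m : ℝ × ℝ → ℝ} (hm : Continuous m) {v : ℝ → ℝ} {a b : ℝ}
    (hab : a ≤ b) (hv : IntervalIntegrable v volume a b) :
    ∫ x in a..b, ∫ y in a..x, m (x, y) * v y = ∫ y in a..b, (∫ x in y..b, m (x, y)) * v y := by
  rw [intervalIntegral.integral_of_le hab, intervalIntegral.integral_of_le hab]
  have h := integral_integral_swap (f := fun x y =>
    {q : ℝ × ℝ | q.2 ≤ q.1}.indicator (fun q => m q * v q.2) (x, y))
    (integrable_indicator_triangle hm hab hv)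
  rw [← setIntegral_congr_fun measurableSet_Ioc fun x hx => integral_indicator_triangle_left hx, h]
  exact setIntegral_congr_fun measurableSet_Ioc fun y hy => integral_indicator_triangle_right hy

/-- The Volterra integral with kernel `k`. -/
noncomputable def volterra (k : ℝ × ℝ → ℝ) (v : ℝ → ℝ) (x : ℝ) : ℝ :=
  ∫ y in (0 : ℝ)..x, k (x, y) * v y

section

variable {k : ℝ × ℝ → ℝ} {v : ℝ → ℝ} {κ : ℝ}

/-- Cauchy–Schwarz on `[0, x]`. Keeping the integral of `v²` up to `x` only, rather than up to 1, is
what lets an exponential weight absorb it in the lower bound for the transform. -/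
theorem volterra_sq_le (hk : Continuous k) (hκ : ∀ p ∈ triangle, |k p| ≤ κ)
    (hv : MemLp v 2 (volume.restrict (Icc 0 1))) {x : ℝ} (hx : x ∈ Icc (0 : ℝ) 1) :
    volterra k v x ^ 2 ≤ κ ^ 2 * ∫ y in (0 : ℝ)..x, v y ^ 2 :=
  integral_mul_sq_le_of_abs_le hx.1 (by linarith [hx.2]) (by fun_prop)
    (fun y hy => hκ (x, y) ⟨hy.1, hy.2, hx.2⟩)
    (hv.mono_measure (Measure.restrict_mono (Icc_subset_Icc_right hx.2) le_rfl))

theorem memLp_volterra (hk : Continuous k) (hv : MemLp v 2 (volume.restrict (Icc 0 1))) :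
    MemLp (volterra k v) 2 (volume.restrict (Icc 0 1)) := by
  obtain ⟨C, hC⟩ := ((isCompact_Icc (a := (0 : ℝ)) (b := 1)).prod
    (isCompact_Icc (a := (0 : ℝ)) (b := 1))).exists_bound_of_continuousOn hk.continuousOn
  have hint := intervalIntegrable_integral_triangle hk zero_le_one
    (hv.intervalIntegrable_of_Icc zero_le_one)
  have hmeas : AEStronglyMeasurable (volterra k v) (volume.restrict (Icc 0 1)) := by
    rw [← restrict_Ioc_eq_restrict_Icc]
    exact ((intervalIntegrable_iff_integrableOn_Ioc_of_le zero_le_one).1 hint).aestronglyMeasurable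
  have hsq := hv.intervalIntegrable_sq_of_Icc zero_le_one
  refine MemLp.of_bound hmeas (Real.sqrt (C ^ 2 * ∫ y in (0 : ℝ)..1, v y ^ 2)) ?_
  filter_upwards [ae_restrict_mem measurableSet_Icc] with x hx
  rw [Real.norm_eq_abs]
  refine Real.abs_le_sqrt ((volterra_sq_le hk (κ := C) (fun p hp => hC p
    ⟨⟨hp.1.trans hp.2.1, hp.2.2⟩, hp.1, hp.2.1.trans hp.2.2⟩) hv hx).trans ?_)
  gcongr
  exact intervalIntegral.integral_mono_interval le_rfl hx.1 hx.2
    (Filter.Eventually.of_forall fun y => sq_nonneg _) hsq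

theorem integral_sub_volterra_sq_le (hk : Continuous k) (hκ : ∀ p ∈ triangle, |k p| ≤ κ)
    (hv : MemLp v 2 (volume.restrict (Icc 0 1))) :
    ∫ x in (0 : ℝ)..1, (v x - volterra k v x) ^ 2
      ≤ 2 * (1 + κ ^ 2) * ∫ x in (0 : ℝ)..1, v x ^ 2 := by
  have hw := hv.sub (memLp_volterra hk hv)
  have hsq := hv.intervalIntegrable_sq_of_Icc zero_le_one
  calc _ ≤ ∫ x in (0 : ℝ)..1, (2 * v x ^ 2 + 2 * κ ^ 2 * ∫ y in (0 : ℝ)..1, v y ^ 2) := by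
        refine intervalIntegral.integral_mono_on zero_le_one
          (hw.intervalIntegrable_sq_of_Icc zero_le_one)
          ((hsq.const_mul 2).add intervalIntegrable_const) fun x hx => ?_
        have h1 := volterra_sq_le hk hκ hv hx
        have h2 : ∫ y in (0 : ℝ)..x, v y ^ 2 ≤ ∫ y in (0 : ℝ)..1, v y ^ 2 :=
          intervalIntegral.integral_mono_interval le_rfl hx.1 hx.2
            (Filter.Eventually.of_forall fun y => sq_nonneg _) hsq
        have h3 := mul_le_mul_of_nonneg_left h2 (sq_nonneg κ)
        nlinarith [sq_nonneg (v x + volterra k v x)]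
    _ = _ := by
        rw [intervalIntegral.integral_add (hsq.const_mul 2) intervalIntegrable_const,
          intervalIntegral.integral_const_mul, intervalIntegral.integral_const]
        simp only [sub_zero, one_smul]
        ring

/-- The operator `v ↦ v - volterra k v` is bounded below in `L²(0, 1)`. -/
theorem integral_sq_le_of_sub_volterra (hk : Continuous k) (hκ : ∀ p ∈ triangle, |k p| ≤ κ)
    (hκ0 : 0 < κ) (hv : MemLp v 2 (volume.restrict (Icc 0 1))) :
    ∫ x in (0 : ℝ)..1, v x ^ 2
      ≤ 4 * Real.exp (4 * κ ^ 2) * ∫ x in (0 : ℝ)..1, (v x - volterra k v x) ^ 2 := by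
  -- From `v² ≤ 2(v - Vv)² + 2(Vv)²`, weighted by `exp (-lam * x)`, the Volterra term costs the
  -- factor `2κ² / lam`. This choice makes it 1/2, so it is absorbed without constructing an inverse
  -- kernel.
  set lam := 4 * κ ^ 2 with hlam
  have hlam0 : 0 < lam := by positivity
  have hw := (hv.sub (memLp_volterra hk hv)).intervalIntegrable_sq_of_Icc zero_le_one
  simp only [Pi.sub_apply] at hw
  have hsq := hv.intervalIntegrable_sq_of_Icc zero_le_one
  let E : ℝ → ℝ := fun x => Real.exp (-(lam * x))
  have hE : Continuous E := by fun_prop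
  have hmulE : ∀ {c : ℝ → ℝ}, IntervalIntegrable c volume 0 1 →
      IntervalIntegrable (fun x => E x * c x) volume 0 1 := fun h =>
    h.continuousOn_mul hE.continuousOn
  have hP : IntervalIntegrable (fun x => ∫ y in (0 : ℝ)..x, E x * v y ^ 2) volume 0 1 :=
    intervalIntegrable_integral_triangle (m := fun p => E p.1) (by fun_prop) zero_le_one hsq
  -- After exchanging the integrals, the tail of the weight satisfies `∫_y^1 E ≤ E y / lam`.
  have h1 : ∫ x in (0 : ℝ)..1, ∫ y in (0 : ℝ)..x, E x * v y ^ 2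
      ≤ 1 / lam * ∫ x in (0 : ℝ)..1, E x * v x ^ 2 := by
    rw [integral_integral_triangle (m := fun p => E p.1) (by fun_prop) zero_le_one hsq,
      ← intervalIntegral.integral_const_mul]
    have hEint : ∀ y, ∫ x in y..1, E x = 1 / lam * E y - 1 / lam * E 1 := by
      intro y
      rw [intervalIntegral.integral_eq_sub_of_hasDerivAt (f := fun x => -(1 / lam) * E x)
        (fun x _ => ?_) (hE.intervalIntegrable _ _)]
      · ring
      · have h3 := ((((hasDerivAt_id x).const_mul lam).neg).exp).const_mul (-(1 / lam))
        have h4 : E x = -(1 / lam) * (Real.exp (-(lam * x)) * -(lam * 1)) := by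
          simp only [E]
          field_simp
        rw [h4]
        exact h3
    refine intervalIntegral.integral_mono_on zero_le_one ?_ ((hmulE hsq).const_mul _) fun y _ => ?_
    · simp only [hEint]
      exact hsq.continuousOn_mul (by fun_prop)
    · simp only [hEint]
      have h5 : 0 ≤ 1 / lam * E 1 * v y ^ 2 := by positivity
      linarith
  have h2 : ∫ x in (0 : ℝ)..1, E x * v x ^ 2 ≤
      2 * (∫ x in (0 : ℝ)..1, E x * (v x - volterra k v x) ^ 2)
        + 2 * κ ^ 2 * ∫ x in (0 : ℝ)..1, ∫ y in (0 : ℝ)..x, E x * v y ^ 2 := by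
    rw [← intervalIntegral.integral_const_mul, ← intervalIntegral.integral_const_mul,
      ← intervalIntegral.integral_add ((hmulE hw).const_mul _) (hP.const_mul _)]
    refine intervalIntegral.integral_mono_on zero_le_one (hmulE hsq)
      (((hmulE hw).const_mul _).add (hP.const_mul _)) fun x hx => ?_
    have h3 := volterra_sq_le hk hκ hv hx
    have h4 : v x ^ 2 ≤ 2 * (v x - volterra k v x) ^ 2
        + 2 * (κ ^ 2 * ∫ y in (0 : ℝ)..x, v y ^ 2) := by
      nlinarith [sq_nonneg (v x - 2 * volterra k v x)]
    rw [intervalIntegral.integral_const_mul]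
    have h5 := mul_le_mul_of_nonneg_left h4 (Real.exp_pos (-(lam * x))).le
    calc E x * v x ^ 2 ≤ _ := h5
      _ = _ := by simp only [E]; ring
  have h3 : 2 * κ ^ 2 * ∫ x in (0 : ℝ)..1, ∫ y in (0 : ℝ)..x, E x * v y ^ 2
      ≤ 1 / 2 * ∫ x in (0 : ℝ)..1, E x * v x ^ 2 := by
    calc _ ≤ 2 * κ ^ 2 * (1 / lam * ∫ x in (0 : ℝ)..1, E x * v x ^ 2) := by gcongr
      _ = _ := by
        rw [hlam]
        field_simp
        ring
  have h4 : Real.exp (-lam) * ∫ x in (0 : ℝ)..1, v x ^ 2 ≤ ∫ x in (0 : ℝ)..1, E x * v x ^ 2 := by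
    rw [← intervalIntegral.integral_const_mul]
    refine intervalIntegral.integral_mono_on zero_le_one (hsq.const_mul _) (hmulE hsq)
      fun x hx => ?_
    gcongr
    exact Real.exp_le_exp.2 (neg_le_neg (mul_le_of_le_one_right hlam0.le hx.2))
  have h5 : ∫ x in (0 : ℝ)..1, E x * (v x - volterra k v x) ^ 2
      ≤ ∫ x in (0 : ℝ)..1, (v x - volterra k v x) ^ 2 := by
    refine intervalIntegral.integral_mono_on zero_le_one (hmulE hw) hw fun x hx => ?_
    refine mul_le_of_le_one_left (sq_nonneg _) ?_
    exact Real.exp_le_one_iff.2 (neg_nonpos.2 (mul_nonneg hlam0.le hx.1))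
  have h6 : Real.exp (-lam) * ∫ x in (0 : ℝ)..1, v x ^ 2
      ≤ 4 * ∫ x in (0 : ℝ)..1, (v x - volterra k v x) ^ 2 := by linarith
  calc ∫ x in (0 : ℝ)..1, v x ^ 2
      = Real.exp lam * (Real.exp (-lam) * ∫ x in (0 : ℝ)..1, v x ^ 2) := by
        rw [← mul_assoc, ← Real.exp_add, add_neg_cancel, Real.exp_zero, one_mul]
    _ ≤ Real.exp lam * (4 * ∫ x in (0 : ℝ)..1, (v x - volterra k v x) ^ 2) := by gcongr
    _ = _ := by ring

end

/-! ### The state space. -/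

section StateSpace

theorem stateL2_memLp (v : StateL2) : MemLp v 2 (volume.restrict (Icc 0 1)) := Lp.memLp v

theorem stateL2_norm_sq (v : StateL2) : ‖v‖ ^ 2 = ∫ x in (0 : ℝ)..1, v x ^ 2 := by
  rw [← real_inner_self_eq_norm_sq, L2.inner_def, intervalIntegral.integral_of_le zero_le_one,
    ← integral_Icc_eq_integral_Ioc]
  refine integral_congr_ae (Filter.Eventually.of_forall fun x => ?_)
  exact (sq (v x)).symm

theorem continuousOn_integral_mul_state {c : ℝ → ℝ} (hc : ContinuousOn c (Icc 0 1))
    {u : ℝ → StateL2} {s : Set ℝ} (hu : ContinuousOn u s) :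
    ContinuousOn (fun t => ∫ x in (0 : ℝ)..1, c x * u t x) s := by
  obtain ⟨C, hC⟩ := isCompact_Icc.exists_bound_of_continuousOn hc
  have hcm : MemLp c 2 (volume.restrict (Icc 0 1)) :=
    MemLp.of_bound (hc.aestronglyMeasurable measurableSet_Icc) C
      (by filter_upwards [ae_restrict_mem measurableSet_Icc] with x hx using hC x hx)
  have h : ContinuousOn (fun t => inner ℝ (u t) (hcm.toLp c)) s := hu.inner continuousOn_const
  refine h.congr fun t _ => ?_
  change _ = inner ℝ (u t) (hcm.toLp c)
  rw [L2.inner_def, intervalIntegral.integral_of_le zero_le_one, ← integral_Icc_eq_integral_Ioc]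
  refine integral_congr_ae ?_
  filter_upwards [hcm.coeFn_toLp] with x hx
  rw [hx]
  rfl

end StateSpace

/-! ### Duality: test functions adapted to the kernel. -/

/-- The adjoint of `v ↦ v - volterra k v`, applied to the exponential `x ↦ exp (s x)`. -/
noncomputable def adjointExp (k : ℝ × ℝ → ℝ) (s y : ℝ) : ℝ :=
  Real.exp (s * y) - ∫ x in y..1, k (x, y) * Real.exp (s * x)

section

variable {K Ky k kd F : ℝ × ℝ → ℝ} {g : ℝ → ℝ}

theorem continuous_adjointExp (hk : Continuous k) (s : ℝ) : Continuous (adjointExp k s) := by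
  have h : ∀ y, adjointExp k s y
      = Real.exp (s * y) + ∫ x in (1 : ℝ)..y, k (x, y) * Real.exp (s * x) := fun y => by
    rw [intervalIntegral.integral_symm, ← sub_eq_add_neg]
    rfl
  have h' : Continuous fun y : ℝ =>
      Real.exp (s * y) + ∫ x in (1 : ℝ)..y, k (x, y) * Real.exp (s * x) := by fun_prop
  exact h'.congr fun y => (h y).symm

theorem adjointExp_one (s : ℝ) : adjointExp k s 1 = Real.exp s := by
  simp [adjointExp]

theorem hasDerivAt_adjointExp (hK : Continuous K) (hKy : Continuous Ky)
    (hKd : ∀ z y, HasDerivAt (fun y => K (z, y)) (Ky (z, y)) y) (s y : ℝ) :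
    HasDerivAt (adjointExp (fun p => K (p.1 - p.2, p.2)) s)
      (s * adjointExp (fun p => K (p.1 - p.2, p.2)) s y + K (1 - y, y) * Real.exp s
        - ∫ x in y..1, Ky (x - y, y) * Real.exp (s * x)) y := by
  have hsub : ∀ (H : ℝ × ℝ → ℝ) (y : ℝ), ∫ x in y..1, H (x - y, y) * Real.exp (s * x)
      = Real.exp (s * y) * ∫ z in (0 : ℝ)..(1 - y), H (z, y) * Real.exp (s * z) := by
    intro H y
    have h := intervalIntegral.integral_comp_add_right (a := 0) (b := 1 - y)
      (fun x => H (x - y, y) * Real.exp (s * x)) y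
    rw [zero_add, sub_add_cancel] at h
    rw [← h, ← intervalIntegral.integral_const_mul]
    congr 1
    funext z
    rw [add_sub_cancel_right, mul_add, Real.exp_add]
    ring
  -- With `z = x - y` as integration variable, the kernel is differentiated at constant `z`, so only
  -- `Ky` appears.
  have hA : adjointExp (fun p => K (p.1 - p.2, p.2)) s = fun y =>
      Real.exp (s * y) * (1 - ∫ z in (0 : ℝ)..(1 - y), K (z, y) * Real.exp (s * z)) := by
    funext y
    simp only [adjointExp]
    rw [hsub K y]
    ring
  have h1 := hasDerivAt_integral_variable_limit
    (m := fun p => K (p.2, p.1) * Real.exp (s * p.2))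
    (m' := fun p => Ky (p.2, p.1) * Real.exp (s * p.2)) (by fun_prop) (by fun_prop)
    (fun y z => (hKd z y).mul_const (Real.exp (s * z))) ((hasDerivAt_id y).const_sub 1)
  have h2 := (((hasDerivAt_id y).const_mul s).exp).mul (h1.const_sub 1)
  rw [hsub Ky y, hA]
  refine h2.congr_deriv ?_
  have h3 : Real.exp s = Real.exp (s * y) * Real.exp (s * (1 - y)) := by
    rw [← Real.exp_add]
    congr 1
    ring
  simp only [id, mul_one, h3]
  ring

/-- Duality by Fubini on the triangle. The free lower limit serves both `a = 0`, for the state and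
`g`, and `a = y`, for the column `F (·, y)`. -/
theorem integral_mul_adjointExp (hk : Continuous k) {v : ℝ → ℝ} {a : ℝ} (ha : a ≤ 1)
    (hv : IntervalIntegrable v volume a 1) (s : ℝ) :
    ∫ y in a..1, v y * adjointExp k s y
      = ∫ x in a..1, (v x - ∫ y in a..x, k (x, y) * v y) * Real.exp (s * x) := by
  have hE : Continuous fun x => Real.exp (s * x) := by fun_prop
  have h1 := integral_integral_triangle (m := fun p => k p * Real.exp (s * p.1)) (by fun_prop)
    ha hv
  have hA := continuous_adjointExp hk s
  have hB : Continuous fun ξ => ∫ x in ξ..1, k (x, ξ) * Real.exp (s * x) := by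
    have : Continuous fun ξ => Real.exp (s * ξ) - adjointExp k s ξ := by fun_prop
    refine this.congr fun ξ => ?_
    simp only [adjointExp]
    ring
  have h2 : ∫ y in a..1, v y * adjointExp k s y
      = (∫ y in a..1, v y * Real.exp (s * y))
        - ∫ y in a..1, (∫ x in y..1, k (x, y) * Real.exp (s * x)) * v y := by
    rw [← intervalIntegral.integral_sub (hv.mul_continuousOn hE.continuousOn)
      (hv.continuousOn_mul hB.continuousOn)]
    congr 1
    funext ξ
    simp only [adjointExp]
    ring
  rw [h2, ← h1, ← intervalIntegral.integral_sub (hv.mul_continuousOn hE.continuousOn)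
    (intervalIntegrable_integral_triangle (m := fun p => k p * Real.exp (s * p.1)) (by fun_prop)
      ha hv)]
  congr 1
  funext x
  have h3 : ∫ y in a..x, k (x, y) * Real.exp (s * x) * v y
      = Real.exp (s * x) * ∫ y in a..x, k (x, y) * v y := by
    rw [← intervalIntegral.integral_const_mul]
    congr 1
    funext ξ
    ring
  rw [h3]
  ring

/-- The hypothesis on `kd` is the interior kernel equation `k_x + k_y = -f + ∫_y^x k(x,ξ) f(ξ,y)
dξ`: the transform of a column of `F` is minus the characteristic derivative of the kernel. -/
theorem integral_kernel_mul_adjointExp (hF : Continuous F) (hk : Continuous k)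
    (hkd : ∀ x y, (x, y) ∈ triangle →
      kd (x, y) = -F (x, y) + ∫ ξ in y..x, k (x, ξ) * F (ξ, y)) (s : ℝ) {y : ℝ}
    (hy : y ∈ Icc (0 : ℝ) 1) :
    ∫ ξ in y..1, F (ξ, y) * adjointExp k s ξ = - ∫ x in y..1, kd (x, y) * Real.exp (s * x) := by
  rw [integral_mul_adjointExp hk hy.2 (Continuous.intervalIntegrable (by fun_prop) _ _),
    ← intervalIntegral.integral_neg]
  refine intervalIntegral.integral_congr fun x hx => ?_
  rw [uIcc_of_le hy.2] at hx
  rw [hkd x y ⟨hy.1, hx.1, hx.2⟩]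
  ring

theorem integral_boundary_mul_adjointExp (hk : Continuous k) (hg : Continuous g)
    (hk0 : ∀ x ∈ Icc (0 : ℝ) 1, k (x, 0) = -g x + volterra k g x) (s : ℝ) :
    ∫ y in (0 : ℝ)..1, g y * adjointExp k s y = adjointExp k s 0 - 1 := by
  rw [integral_mul_adjointExp hk zero_le_one (hg.intervalIntegrable _ _), adjointExp, mul_zero,
    Real.exp_zero, sub_sub_cancel_left, ← intervalIntegral.integral_neg]
  refine intervalIntegral.integral_congr fun x hx => ?_
  rw [uIcc_of_le zero_le_one] at hx
  rw [hk0 x hx, volterra]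
  ring

end

/-- A kernel on the plane, given with its derivative `Ky` in the second variable at constant
`x - y`, which solves on the triangle the characteristic form of the kernel equations for
continuous coefficients `G`, `F`; all arguments are in the coordinates `(x - y, y)`. -/
structure CharacteristicKernel (G : ℝ → ℝ) (F K Ky : ℝ × ℝ → ℝ) : Prop where
  continuous_boundary : Continuous G
  continuous_coeff : Continuous F
  continuous_kernel : Continuous K
  continuous_deriv : Continuous Ky
  hasDerivAt : ∀ z y, HasDerivAt (fun y => K (z, y)) (Ky (z, y)) y
  deriv_eq : EqOn Ky (kernelOpSnd F K) cornerSimplex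
  kernel_eq : EqOn K (kernelOp G F K) cornerSimplex

/-- The passage from the coordinates `(x, y)` to `(x - y, y)`. -/
def shear (H : ℝ × ℝ → ℝ) (p : ℝ × ℝ) : ℝ := H (p.1 - p.2, p.2)

theorem continuous_shear {H : ℝ × ℝ → ℝ} (hH : Continuous H) : Continuous (shear H) := by
  unfold shear
  fun_prop

namespace CharacteristicKernel

variable {G g : ℝ → ℝ} {F K Ky f : ℝ × ℝ → ℝ}

/-- Back in `(x, y)`, this is the interior kernel equation, with `shear Ky` in the role of `k_x +
k_y`. -/
theorem shear_deriv_eq (h : CharacteristicKernel G F K Ky) {x y : ℝ} (hxy : (x, y) ∈ triangle) :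
    shear Ky (x, y) = -shear F (x, y) + ∫ ξ in y..x, shear K (x, ξ) * shear F (ξ, y) := by
  have h1 := intervalIntegral.integral_comp_sub_left (a := 0) (b := x - y)
    (fun ξ => shear K (x, ξ) * shear F (ξ, y)) x
  rw [sub_sub_cancel, sub_zero] at h1
  rw [← h1]
  refine (h.deriv_eq (sub_mem_cornerSimplex hxy)).trans ?_
  unfold kernelOpSnd
  congr 1
  congr 1
  funext σ
  simp only [shear]
  rw [mul_comm, sub_sub_cancel, sub_right_comm x y σ, sub_add_cancel]

theorem shear_boundary_eq (h : CharacteristicKernel G F K Ky) {x : ℝ} (hx : x ∈ Icc (0 : ℝ) 1) :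
    shear K (x, 0) = -G x + volterra (shear K) G x := by
  have h1 := h.kernel_eq (sub_mem_cornerSimplex (x := x) (y := 0) ⟨le_rfl, hx.1, hx.2⟩)
  have h2 := intervalIntegral.integral_comp_sub_left (a := 0) (b := x)
    (fun y => shear K (x, y) * G y) x
  rw [sub_self, sub_zero] at h2
  rw [sub_zero] at h1
  simp only [kernelOp, kernelSource, kernelLin, intervalIntegral.integral_same, sub_zero,
    add_zero] at h1
  rw [volterra, ← h2, shear, sub_zero, h1]
  congr 2
  funext s
  rw [shear, sub_sub_cancel, mul_comm]

/-- The two volume terms containing `Ky`, one from the derivative of the test function and one from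
`f`, cancel. The `g` term contributes `b * (A 0 - 1)` for `A = adjointExp (shear K) s`, so the trace
is left with coefficient `-1`; the boundary part of the derivative supplies the exact feedback
subtracted from `U`. -/
theorem weak_integrand (h : CharacteristicKernel G F K Ky) (hG : EqOn G g (Icc 0 1))
    (hF : ∀ p ∈ cornerSimplex, F p = f (p.1 + p.2, p.2)) {v : ℝ → ℝ}
    (hv : IntervalIntegrable v volume 0 1) (s U b : ℝ) :
    (∫ x in (0 : ℝ)..1, v x * (s * adjointExp (shear K) s x
        - deriv (adjointExp (shear K) s) x))
      + U * adjointExp (shear K) s 1 - b * adjointExp (shear K) s 0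
      + (∫ x in (0 : ℝ)..1, (g x * b + ∫ y in (0 : ℝ)..x, f (x, y) * v y)
          * adjointExp (shear K) s x)
      = (U - ∫ y in (0 : ℝ)..1, shear K (1, y) * v y) * Real.exp s - b := by
  have hk := continuous_shear h.continuous_kernel
  have hFs := continuous_shear h.continuous_coeff
  have hkd := continuous_shear h.continuous_deriv
  have hA := continuous_adjointExp hk s
  have hder : ∀ x, deriv (adjointExp (shear K) s) x = s * adjointExp (shear K) s x
      + shear K (1, x) * Real.exp s - ∫ ξ in x..1, shear Ky (ξ, x) * Real.exp (s * ξ) := fun x =>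
    (hasDerivAt_adjointExp h.continuous_kernel h.continuous_deriv h.hasDerivAt s x).deriv
  have hJ : Continuous fun x => ∫ ξ in x..1, shear Ky (ξ, x) * Real.exp (s * ξ) := by
    have : Continuous fun x => -∫ ξ in (1 : ℝ)..x, shear Ky (ξ, x) * Real.exp (s * ξ) := by
      fun_prop
    exact this.congr fun x => (intervalIntegral.integral_symm _ _).symm
  have hm : Continuous fun p : ℝ × ℝ => shear F p * adjointExp (shear K) s p.1 := by fun_prop
  have h1 : ∫ x in (0 : ℝ)..1, (g x * b + ∫ y in (0 : ℝ)..x, f (x, y) * v y)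
      * adjointExp (shear K) s x
      = b * (∫ x in (0 : ℝ)..1, G x * adjointExp (shear K) s x)
        + ∫ x in (0 : ℝ)..1, ∫ y in (0 : ℝ)..x,
            shear F (x, y) * adjointExp (shear K) s x * v y := by
    have hGc := h.continuous_boundary
    rw [← intervalIntegral.integral_const_mul, ← intervalIntegral.integral_add
      (Continuous.intervalIntegrable (by fun_prop) _ _)
      (intervalIntegrable_integral_triangle hm zero_le_one hv)]
    refine intervalIntegral.integral_congr fun x hx => ?_
    rw [uIcc_of_le zero_le_one] at hx
    have h2 : ∫ y in (0 : ℝ)..x, shear F (x, y) * adjointExp (shear K) s x * v y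
        = (∫ y in (0 : ℝ)..x, f (x, y) * v y) * adjointExp (shear K) s x := by
      rw [← intervalIntegral.integral_mul_const]
      refine intervalIntegral.integral_congr fun y hy => ?_
      rw [uIcc_of_le hx.1] at hy
      have h3 : shear F (x, y) = f (x, y) := by
        rw [shear, hF _ (sub_mem_cornerSimplex ⟨hy.1, hy.2, hx.2⟩), sub_add_cancel]
      rw [h3]
      ring
    rw [h2, hG hx]
    ring
  have h2 : ∀ y ∈ Icc (0 : ℝ) 1, ∫ x in y..1, shear F (x, y) * adjointExp (shear K) s x
      = -∫ ξ in y..1, shear Ky (ξ, y) * Real.exp (s * ξ) := fun y hy =>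
    integral_kernel_mul_adjointExp hFs hk (fun x y hxy => h.shear_deriv_eq hxy) s hy
  have h3 : ∫ x in (0 : ℝ)..1, ∫ y in (0 : ℝ)..x,
      shear F (x, y) * adjointExp (shear K) s x * v y
      = -∫ y in (0 : ℝ)..1, (∫ ξ in y..1, shear Ky (ξ, y) * Real.exp (s * ξ)) * v y := by
    rw [integral_integral_triangle hm zero_le_one hv, ← intervalIntegral.integral_neg]
    refine intervalIntegral.integral_congr fun y hy => ?_
    rw [uIcc_of_le zero_le_one] at hy
    rw [← neg_mul, ← h2 y hy]
  have h4 : ∫ x in (0 : ℝ)..1, v x * (s * adjointExp (shear K) s x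
        - deriv (adjointExp (shear K) s) x)
      = (∫ y in (0 : ℝ)..1, (∫ ξ in y..1, shear Ky (ξ, y) * Real.exp (s * ξ)) * v y)
        - (∫ y in (0 : ℝ)..1, shear K (1, y) * v y) * Real.exp s := by
    have hc : Continuous fun y => shear K (1, y) := by fun_prop
    rw [← intervalIntegral.integral_mul_const, ← intervalIntegral.integral_sub
      (hv.continuousOn_mul hJ.continuousOn)
      ((hv.continuousOn_mul hc.continuousOn).mul_const _)]
    congr 1
    funext x
    rw [hder]
    ring
  rw [h1, h3, h4, adjointExp_one, integral_boundary_mul_adjointExp hk h.continuous_boundary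
    (fun x hx => h.shear_boundary_eq hx)]
  ring

/-- This is the weak form, against exponentials, of `w_t = w_x` with inlet value `U - ∫ k(1,y) u`
and outlet value `b`. Since `e^{s(x+t)}` is constant along characteristics, only data on the
boundary of `[0, 1] × [0, T]` remain. -/
theorem exponential_moments (h : CharacteristicKernel G F K Ky) (hG : EqOn G g (Icc 0 1))
    (hF : ∀ p ∈ cornerSimplex, F p = f (p.1 + p.2, p.2)) {U : ℝ → ℝ} {u : ℝ → StateL2}
    (hu : IsWeakSolution g f U u) :
    ∃ b : ℝ → ℝ, (∀ T, 0 < T → IntervalIntegrable b volume 0 T) ∧ ∀ T, 0 < T → ∀ s : ℝ,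
      (∫ x in (0 : ℝ)..1, (u T x - volterra (shear K) (u T) x) * Real.exp (s * (x + T)))
        + (∫ t in (0 : ℝ)..T, b t * Real.exp (s * t))
      = (∫ x in (0 : ℝ)..1, (u 0 x - volterra (shear K) (u 0) x) * Real.exp (s * x))
        + ∫ t in (0 : ℝ)..T, (U t - ∫ y in (0 : ℝ)..1, shear K (1, y) * u t y)
            * Real.exp (s * (1 + t)) := by
  obtain ⟨huc, hU, b, hb, hweak⟩ := hu
  have hbi : ∀ T, 0 < T → IntervalIntegrable b volume 0 T := fun T hT =>
    (hb T hT).intervalIntegrable_of_Icc hT.le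
  refine ⟨b, hbi, fun T hT s => ?_⟩
  have hk := continuous_shear h.continuous_kernel
  have hkd := continuous_shear h.continuous_deriv
  have hA := continuous_adjointExp hk s
  have hAd := hasDerivAt_adjointExp h.continuous_kernel h.continuous_deriv h.hasDerivAt s
  have hder : Continuous (deriv (adjointExp (shear K) s)) := by
    have : Continuous fun x => s * adjointExp (shear K) s x
        + shear K (1, x) * Real.exp s + ∫ ξ in (1 : ℝ)..x, shear Ky (ξ, x) * Real.exp (s * ξ) := by
      fun_prop
    refine this.congr fun x => ?_
    rw [intervalIntegral.integral_symm, ← sub_eq_add_neg]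
    exact (hAd x).deriv.symm
  have hAd' : ∀ x, HasDerivAt (adjointExp (shear K) s) (deriv (adjointExp (shear K) s) x) x :=
    fun x => (hAd x).differentiableAt.hasDerivAt
  -- Pairing `u` with this function equals pairing its transform with `e^{s(x+t)}`.
  let φ : ℝ × ℝ → ℝ := fun p => adjointExp (shear K) s p.1 * Real.exp (s * p.2)
  let φx : ℝ × ℝ → ℝ := fun p => deriv (adjointExp (shear K) s) p.1 * Real.exp (s * p.2)
  let φt : ℝ × ℝ → ℝ := fun p => adjointExp (shear K) s p.1 * (Real.exp (s * p.2) * (s * 1))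
  have hφx : Continuous φx := by fun_prop
  have hφt : Continuous φt := by fun_prop
  have hdx : ∀ x t, HasDerivAt (fun x => φ (x, t)) (φx (x, t)) x := fun x t =>
    (hAd' x).mul_const (Real.exp (s * t))
  have hdt : ∀ x t, HasDerivAt (fun t => φ (x, t)) (φt (x, t)) t := fun x t =>
    (((hasDerivAt_id t).const_mul s).exp).const_mul (adjointExp (shear K) s x)
  have hw := hweak T hT φ (contDiff_one_of_continuous_partials hφx hφt hdx hdt)
  have hi : ∀ t, IntervalIntegrable (u t) volume 0 1 := fun t =>
    (stateL2_memLp (u t)).intervalIntegrable_of_Icc zero_le_one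
  have hend : ∀ t, ∫ x in (0 : ℝ)..1, u t x * φ (x, t)
      = ∫ x in (0 : ℝ)..1, (u t x - volterra (shear K) (u t) x) * Real.exp (s * (x + t)) := by
    intro t
    have h1 := integral_mul_adjointExp hk zero_le_one (hi t) s
    have h2 : ∀ x, (u t x - volterra (shear K) (u t) x) * Real.exp (s * (x + t))
        = (u t x - volterra (shear K) (u t) x) * Real.exp (s * x) * Real.exp (s * t) := fun x => by
      rw [mul_add, Real.exp_add, mul_assoc]
    simp only [h2]
    rw [intervalIntegral.integral_mul_const]
    simp only [volterra]
    rw [← h1, ← intervalIntegral.integral_mul_const]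
    congr 1
    funext x
    simp only [φ]
    ring
  have hint : ∀ t,
      ((∫ x in (0 : ℝ)..1, u t x * (fderiv ℝ φ (x, t) (0, 1) - fderiv ℝ φ (x, t) (1, 0)))
        + U t * φ (1, t) - b t * φ (0, t)
        + ∫ x in (0 : ℝ)..1, (g x * b t + ∫ y in (0 : ℝ)..x, f (x, y) * u t y) * φ (x, t))
      = (U t - ∫ y in (0 : ℝ)..1, shear K (1, y) * u t y) * Real.exp (s * (1 + t))
        - b t * Real.exp (s * t) := by
    intro t
    have h1 := h.weak_integrand hG hF (hi t) s (U t) (b t)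
    have hfd : ∀ x, fderiv ℝ φ (x, t) (0, 1) - fderiv ℝ φ (x, t) (1, 0)
        = (s * adjointExp (shear K) s x - deriv (adjointExp (shear K) s) x)
          * Real.exp (s * t) := fun x => by
      rw [(hasFDerivAt_of_continuous_partials hφx hφt hdx hdt (x, t)).fderiv]
      simp [φx, φt]
      ring
    simp only [hfd, φ, ← mul_assoc]
    rw [intervalIntegral.integral_mul_const, intervalIntegral.integral_mul_const, ← add_mul,
      ← sub_mul, ← add_mul, h1, mul_add, mul_one, Real.exp_add]
    ring
  simp only [hint, hend] at hw
  have hWi : IntervalIntegrable (fun t => U t - ∫ y in (0 : ℝ)..1, shear K (1, y) * u t y)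
      volume 0 T := by
    refine ((hU T hT).intervalIntegrable_of_Icc hT.le).sub ?_
    refine ContinuousOn.intervalIntegrable_of_Icc hT.le ?_
    exact continuousOn_integral_mul_state
      (c := fun y => shear K (1, y)) (Continuous.continuousOn (by fun_prop))
      (huc.mono Icc_subset_Ici_self)
  rw [intervalIntegral.integral_sub
    (hWi.mul_continuousOn (Continuous.continuousOn (by fun_prop)))
    ((hbi T hT).mul_continuousOn (Continuous.continuousOn (by fun_prop)))] at hw
  simp only [add_zero] at hw
  linarith

end CharacteristicKernel

/-! ### From exponential moments to transport of the boundary data. -/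

/-- The function `α` up to time `c`, followed by `β` started at time `c`. -/
noncomputable def concatAt (c : ℝ) (α β : ℝ → ℝ) (z : ℝ) : ℝ := if z ≤ c then α z else β (z - c)

section Concat

variable {α β : ℝ → ℝ} {c d : ℝ}

theorem concatAt_comp₂ (op : ℝ → ℝ → ℝ) (E : ℝ → ℝ) (z : ℝ) :
    op (concatAt c α β z) (E z)
      = concatAt c (fun z => op (α z) (E z)) (fun z => op (β z) (E (z + c))) z := by
  unfold concatAt
  split_ifs
  · rfl
  · simp only [sub_add_cancel]

theorem intervalIntegrable_concatAt (hc : 0 ≤ c) (hd : 0 ≤ d) (hα : IntervalIntegrable α volume 0 c)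
    (hβ : IntervalIntegrable β volume 0 d) :
    IntervalIntegrable (concatAt c α β) volume 0 c ∧
      IntervalIntegrable (concatAt c α β) volume c (d + c) := by
  constructor
  · refine (intervalIntegrable_congr fun z hz => ?_).1 hα
    rw [uIoc_of_le hc] at hz
    exact (if_pos hz.2).symm
  · have h := hβ.comp_sub_right c
    rw [zero_add] at h
    refine (intervalIntegrable_congr fun z hz => ?_).1 h
    rw [uIoc_of_le (by linarith)] at hz
    exact (if_neg hz.1.not_ge).symm

theorem integral_concatAt_right (hd : 0 ≤ d) :
    ∫ z in c..d + c, concatAt c α β z = ∫ z in (0 : ℝ)..d, β z := by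
  have h := intervalIntegral.integral_comp_sub_right (a := c) (b := d + c) β c
  rw [sub_self, add_sub_cancel_right] at h
  rw [← h]
  exact intervalIntegral.integral_congr_Ioo_of_le (by linarith) fun z hz => if_neg hz.1.not_ge

theorem integral_concatAt (hc : 0 ≤ c) (hd : 0 ≤ d) (hα : IntervalIntegrable α volume 0 c)
    (hβ : IntervalIntegrable β volume 0 d) :
    ∫ z in (0 : ℝ)..d + c, concatAt c α β z
      = (∫ z in (0 : ℝ)..c, α z) + ∫ z in (0 : ℝ)..d, β z := by
  obtain ⟨h1, h2⟩ := intervalIntegrable_concatAt hc hd hα hβ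
  rw [← intervalIntegral.integral_add_adjacent_intervals h1 h2, integral_concatAt_right hd]
  congr 1
  exact intervalIntegral.integral_congr_Ioo_of_le hc fun z hz => if_pos hz.2.le

theorem integral_concatAt_mul (hc : 0 ≤ c) (hd : 0 ≤ d) (hα : IntervalIntegrable α volume 0 c)
    (hβ : IntervalIntegrable β volume 0 d) {E : ℝ → ℝ} (hE : Continuous E) :
    ∫ z in (0 : ℝ)..d + c, concatAt c α β z * E z
      = (∫ z in (0 : ℝ)..c, α z * E z) + ∫ z in (0 : ℝ)..d, β z * E (z + c) := by
  rw [← integral_concatAt hc hd (hα.mul_continuousOn hE.continuousOn)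
    (hβ.mul_continuousOn (Continuous.continuousOn (by fun_prop)))]
  congr 1
  funext z
  exact concatAt_comp₂ (· * ·) E z

end Concat

/-- An integrable function on `(0, L)` with vanishing exponential moments vanishes a.e. -/
theorem ae_eq_zero_of_integral_mul_exp_eq_zero {p : ℝ → ℝ} {L : ℝ} (hL : 0 ≤ L)
    (hp : IntervalIntegrable p volume 0 L)
    (h : ∀ n : ℕ, ∫ z in (0 : ℝ)..L, p z * Real.exp (n * z) = 0) :
    ∀ᵐ z, z ∈ Ioo 0 L → p z = 0 := by
  -- Moments at natural numbers are moments against powers of `e^z`. Weierstrass approximation of `φ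
  -- ∘ log` on `[1, e^L]` then reaches every continuous `φ`.
  have hpoly : ∀ P : Polynomial ℝ, ∫ z in (0 : ℝ)..L, p z * P.eval (Real.exp z) = 0 := by
    intro P
    induction P using Polynomial.induction_on' with
    | add P Q hP hQ =>
      simp only [Polynomial.eval_add, mul_add]
      rw [intervalIntegral.integral_add
        (hp.mul_continuousOn (Continuous.continuousOn (by fun_prop)))
        (hp.mul_continuousOn (Continuous.continuousOn (by fun_prop))), hP, hQ, add_zero]
    | monomial n a =>
      have h1 : ∀ z, p z * (Polynomial.monomial n a).eval (Real.exp z)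
          = a * (p z * Real.exp (n * z)) := fun z => by
        rw [Polynomial.eval_monomial, Real.exp_nat_mul]
        ring
      simp only [h1]
      rw [intervalIntegral.integral_const_mul, h n, mul_zero]
  have hcont : ∀ φ : ℝ → ℝ, Continuous φ → ∫ z in (0 : ℝ)..L, p z * φ z = 0 := by
    intro φ hφ
    have hlog : ContinuousOn (fun v => φ (Real.log v)) (Icc 1 (Real.exp L)) :=
      hφ.comp_continuousOn (Real.continuousOn_log.mono fun v hv =>
        (zero_lt_one.trans_le hv.1).ne')
    have hI : 0 ≤ ∫ z in (0 : ℝ)..L, |p z| :=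
      intervalIntegral.integral_nonneg hL fun z _ => abs_nonneg _
    have hsmall : ∀ ε > 0, |∫ z in (0 : ℝ)..L, p z * φ z| ≤ ε * ∫ z in (0 : ℝ)..L, |p z| := by
      intro ε hε
      obtain ⟨P, hP⟩ := exists_polynomial_near_of_continuousOn 1 (Real.exp L) _ hlog ε hε
      have hPc : Continuous fun z => P.eval (Real.exp z) := by fun_prop
      have h1 : ∫ z in (0 : ℝ)..L, p z * φ z
          = ∫ z in (0 : ℝ)..L, p z * (φ z - P.eval (Real.exp z)) := by
        simp only [mul_sub]
        rw [intervalIntegral.integral_sub (hp.mul_continuousOn hφ.continuousOn)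
          (hp.mul_continuousOn hPc.continuousOn), hpoly, sub_zero]
      rw [h1, ← intervalIntegral.integral_const_mul, ← Real.norm_eq_abs]
      refine intervalIntegral.norm_integral_le_of_norm_le hL
        (Filter.Eventually.of_forall fun z hz => ?_) (hp.norm.const_mul ε)
      have h2 := hP (Real.exp z) ⟨Real.one_le_exp hz.1.le, Real.exp_le_exp.2 hz.2⟩
      rw [Real.log_exp, abs_sub_comm] at h2
      rw [norm_mul, mul_comm]
      exact mul_le_mul_of_nonneg_right h2.le (norm_nonneg _)
    have h0 : |∫ z in (0 : ℝ)..L, p z * φ z| ≤ 0 := by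
      refine le_of_forall_pos_le_add fun δ hδ => ?_
      refine (hsmall (δ / ((∫ z in (0 : ℝ)..L, |p z|) + 1)) (by positivity)).trans ?_
      rw [zero_add, div_mul_eq_mul_div, div_le_iff₀ (by positivity)]
      gcongr
      linarith
    exact abs_nonpos_iff.1 h0
  refine isOpen_Ioo.ae_eq_zero_of_integral_contDiff_smul_eq_zero ?_ fun φ hφ _ hsupp => ?_
  · exact (((intervalIntegrable_iff_integrableOn_Ioc_of_le hL).1 hp).mono_set
      Ioo_subset_Ioc_self).locallyIntegrableOn
  · have h1 : ∫ z, φ z • p z = ∫ z in Ioo 0 L, φ z • p z := by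
      refine (setIntegral_eq_integral_of_forall_compl_eq_zero fun z hz => ?_).symm
      rw [image_eq_zero_of_notMem_tsupport fun hz' => hz (hsupp hz'), zero_smul]
    rw [h1, ← integral_Ioc_eq_integral_Ioo, ← intervalIntegral.integral_of_le hL]
    simpa only [smul_eq_mul, mul_comm] using hcont φ hφ.continuous

/-- A weak solution of the transport equation is a window of its prolongated boundary data. -/
theorem integral_sq_eq_of_exponential_moments {w₀ w b W : ℝ → ℝ} {T : ℝ} (hT : 0 ≤ T)
    (hw₀ : IntervalIntegrable w₀ volume 0 1) (hw : IntervalIntegrable w volume 0 1)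
    (hb : IntervalIntegrable b volume 0 T) (hW : IntervalIntegrable W volume 0 T)
    (h : ∀ s : ℝ, (∫ x in (0 : ℝ)..1, w x * Real.exp (s * (x + T)))
        + (∫ t in (0 : ℝ)..T, b t * Real.exp (s * t))
      = (∫ x in (0 : ℝ)..1, w₀ x * Real.exp (s * x))
        + ∫ t in (0 : ℝ)..T, W t * Real.exp (s * (1 + t))) :
    ∫ x in (0 : ℝ)..1, w x ^ 2 = ∫ z in T..T + 1, concatAt 1 w₀ W z ^ 2 := by
  have hp := intervalIntegrable_concatAt hT zero_le_one hb hw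
  have hp' := hp.1.trans hp.2
  have hq := intervalIntegrable_concatAt zero_le_one hT hw₀ hW
  have hq' := hq.1.trans hq.2
  rw [add_comm] at hp'
  have hL : 0 ≤ T + 1 := by linarith
  -- Both concatenations have length `T + 1`, so equality of moments identifies them on `(0, T +
  -- 1)`; the last unit of the first one is `w`.
  have hae := ae_eq_zero_of_integral_mul_exp_eq_zero hL (hp'.sub hq') fun n => by
    have hE : Continuous fun z : ℝ => Real.exp (n * z) := by fun_prop
    have h1 := integral_concatAt_mul hT zero_le_one hb hw hE
    have h2 := integral_concatAt_mul zero_le_one hT hw₀ hW hE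
    rw [add_comm] at h1
    simp only [sub_mul]
    rw [intervalIntegral.integral_sub (hp'.mul_continuousOn hE.continuousOn)
      (hq'.mul_continuousOn hE.continuousOn), h1, h2, add_comm (∫ z in (0 : ℝ)..T, _), h n]
    simp only [add_comm, sub_self]
  have h3 := integral_concatAt_right (c := T) (d := 1) (α := fun z => b z ^ 2)
    (β := fun z => w z ^ 2) zero_le_one
  rw [← h3, add_comm 1 T]
  refine intervalIntegral.integral_congr_ae ?_
  filter_upwards [hae, Measure.ae_ne volume (T + 1)] with z hz hne hzm
  rw [uIoc_of_le (by linarith)] at hzm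
  have h4 := hz ⟨hT.trans_lt hzm.1, lt_of_le_of_ne hzm.2 hne⟩
  rw [sub_eq_zero] at h4
  rw [← h4]
  exact (concatAt_comp₂ (fun a _ => a ^ 2) id z).symm

/-! ### Exponential decay of the closed loop. -/

/-- Decay of windows of a square integrable signal controlled by the preceding windows. -/
theorem decay_of_window_bound {q N : ℝ → ℝ}
    (hq : ∀ a b, 0 ≤ a → a ≤ b → IntervalIntegrable (fun z => q z ^ 2) volume a b)
    (hN : ∀ T, 0 ≤ T → N T = ∫ z in T..T + 1, q z ^ 2)
    (hqN : ∀ z, 1 < z → q z ^ 2 ≤ N (z - 1) / 4) {T : ℝ} (hT : 0 ≤ T) :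
    N T ≤ 4 * Real.exp (-Real.log 2 * T) * N 0 := by
  have hN0 : ∀ T, 0 ≤ T → 0 ≤ N T := fun T hT => by
    rw [hN T hT]
    exact intervalIntegral.integral_nonneg (by linarith) fun z _ => sq_nonneg _
  -- The window `[t, t + 1]` lies in `[n, n + 2]`, which allows comparison with integer times only.
  have hwin : ∀ (n : ℕ) (t : ℝ), (n : ℝ) ≤ t → t ≤ n + 1 → N t ≤ N n + N (n + 1) := by
    intro n t h1 h2
    have hn : (0 : ℝ) ≤ n := n.cast_nonneg
    rw [hN t (hn.trans h1), hN n hn, hN (n + 1) (by linarith),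
      intervalIntegral.integral_add_adjacent_intervals (hq _ _ hn (by linarith))
        (hq _ _ (by linarith) (by linarith))]
    exact intervalIntegral.integral_mono_interval h1 (by linarith) (by linarith)
      (Filter.Eventually.of_forall fun y => sq_nonneg _) (hq _ _ hn (by linarith))
  have hstep : ∀ n : ℕ, N (n + 1) ≤ N n / 2 := by
    intro n
    have hn : (0 : ℝ) ≤ n := n.cast_nonneg
    -- The unknown `N (n + 1)` reappears with weight 1/4; absorbing it leaves a factor 1/3, weakened
    -- to 1/2.
    have h1 : N (n + 1) ≤ (N n + N (n + 1)) / 4 := by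
      calc N (n + 1) = ∫ z in (n + 1 : ℝ)..n + 1 + 1, q z ^ 2 := hN _ (by linarith)
        _ ≤ ∫ _ in (n + 1 : ℝ)..n + 1 + 1, (N n + N (n + 1)) / 4 := by
          refine intervalIntegral.integral_mono_on_of_le_Ioo (by linarith)
            (hq _ _ (by linarith) (by linarith)) intervalIntegrable_const fun z hz => ?_
          have h2 := hqN z (by linarith [hz.1])
          have h3 := hwin n (z - 1) (by linarith [hz.1]) (by linarith [hz.2])
          linarith
        _ = _ := by simp
    have h2 := hN0 n hn
    linarith
  have hgeom : ∀ n : ℕ, N n ≤ (1 / 2) ^ n * N 0 := by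
    intro n
    induction n with
    | zero => simp
    | succ n ih =>
      have h1 := hstep n
      push_cast
      rw [pow_succ]
      linarith
  have h1 := hwin ⌊T⌋₊ T (Nat.floor_le hT) (Nat.lt_floor_add_one T).le
  have h2 := hstep ⌊T⌋₊
  have h3 := hgeom ⌊T⌋₊
  have h4 := hN0 ⌊T⌋₊ (Nat.cast_nonneg _)
  -- The factor 2 pays for replacing `⌊T⌋₊` by `T`.
  have h5 : ((1 : ℝ) / 2) ^ ⌊T⌋₊ ≤ 2 * Real.exp (-Real.log 2 * T) := by
    have h6 : ((1 : ℝ) / 2) ^ ⌊T⌋₊ = Real.exp (-Real.log 2 * ⌊T⌋₊) := by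
      rw [mul_comm, Real.exp_nat_mul, Real.exp_neg, Real.exp_log two_pos, one_div]
    have h7 : 2 * Real.exp (-Real.log 2 * T) = Real.exp (Real.log 2 + -Real.log 2 * T) := by
      rw [Real.exp_add, Real.exp_log two_pos]
    rw [h6, h7]
    refine Real.exp_le_exp.2 ?_
    have := mul_le_mul_of_nonneg_left (Nat.lt_floor_add_one T).le (Real.log_nonneg one_le_two)
    linarith
  have h6 := mul_le_mul_of_nonneg_right h5 (hN0 0 le_rfl)
  linarith

/-- The constant 32 is the product of 4 from the lower bound on the transform, 4 from the window
decay and 2 from the upper bound. The square root halves the rate `log 2` of the energy. -/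
theorem CharacteristicKernel.norm_le_mul_exp {G g : ℝ → ℝ} {F K Ky f khat : ℝ × ℝ → ℝ} {κ ε : ℝ}
    (h : CharacteristicKernel G F K Ky) (hG : EqOn G g (Icc 0 1))
    (hF : ∀ p ∈ cornerSimplex, F p = f (p.1 + p.2, p.2)) (hκ0 : 0 < κ)
    (hκ : ∀ p ∈ triangle, |shear K p| ≤ κ) (hkhat : ContinuousOn khat triangle)
    (hε : ∀ y ∈ Icc (0 : ℝ) 1, |khat (1, y) - shear K (1, y)| ≤ ε)
    (hεκ : ε ^ 2 * (4 * Real.exp (4 * κ ^ 2)) ≤ 1 / 4) {u : ℝ → StateL2}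
    (hu : IsClosedLoopSolution g f khat u) {t : ℝ} (ht : 0 ≤ t) :
    ‖u t‖ ≤ Real.sqrt (32 * Real.exp (4 * κ ^ 2) * (1 + κ ^ 2))
      * Real.exp (-Real.log 2 * t / 2) * ‖u 0‖ := by
  have hk := continuous_shear h.continuous_kernel
  obtain ⟨b, hb, hmom⟩ := h.exponential_moments hG hF hu
  have huc : ContinuousOn u (Ici 0) := hu.1
  let w : ℝ → ℝ → ℝ := fun t x => u t x - volterra (shear K) (u t) x
  have hwm : ∀ t, MemLp (w t) 2 (volume.restrict (Icc 0 1)) := fun t =>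
    (stateL2_memLp (u t)).sub (memLp_volterra hk (stateL2_memLp (u t)))
  let N : ℝ → ℝ := fun t => ∫ x in (0 : ℝ)..1, w t x ^ 2
  have hlower : ∀ t, ‖u t‖ ^ 2 ≤ 4 * Real.exp (4 * κ ^ 2) * N t := fun t => by
    rw [stateL2_norm_sq]
    exact integral_sq_le_of_sub_volterra hk hκ hκ0 (stateL2_memLp (u t))
  have hupper : ∀ t, N t ≤ 2 * (1 + κ ^ 2) * ‖u t‖ ^ 2 := fun t => by
    rw [stateL2_norm_sq]
    exact integral_sub_volterra_sq_le hk hκ (stateL2_memLp (u t))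
  have hslice : ContinuousOn (fun y => khat (1, y)) (Icc 0 1) :=
    hkhat.comp (by fun_prop) fun y hy => ⟨hy.1, hy.2, le_rfl⟩
  have hslice' : ContinuousOn (fun y => shear K (1, y)) (Icc 0 1) :=
    Continuous.continuousOn (by fun_prop)
  let W : ℝ → ℝ := fun t => feedback khat u t - ∫ y in (0 : ℝ)..1, shear K (1, y) * u t y
  have hWc : ContinuousOn W (Ici 0) :=
    (continuousOn_integral_mul_state hslice huc).sub (continuousOn_integral_mul_state hslice' huc)
  have hWi : ∀ T, 0 ≤ T → IntervalIntegrable W volume 0 T := fun T hT =>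
    (hWc.mono Icc_subset_Ici_self).intervalIntegrable_of_Icc hT
  -- `W` pairs the gain error with `u`, hence `W² ≤ ε²‖u‖²`; the lower bound on the transform and
  -- the smallness of `ε` turn this into a bound by `N`.
  have hW : ∀ t, W t ^ 2 ≤ N t / 4 := by
    intro t
    have hi := (stateL2_memLp (u t)).intervalIntegrable_of_Icc zero_le_one
    have h1 : W t = ∫ y in (0 : ℝ)..1, (khat (1, y) - shear K (1, y)) * u t y := by
      simp only [sub_mul]
      rw [intervalIntegral.integral_sub]
      · rfl
      · exact hi.continuousOn_mul (by rwa [uIcc_of_le zero_le_one])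
      · exact hi.continuousOn_mul (by rwa [uIcc_of_le zero_le_one])
    have h2 := integral_mul_sq_le_of_abs_le zero_le_one (by norm_num) (hslice.sub hslice') hε
      (stateL2_memLp (u t))
    rw [h1]
    refine h2.trans ?_
    rw [← stateL2_norm_sq]
    have hN0 : 0 ≤ N t := intervalIntegral.integral_nonneg zero_le_one fun x _ => sq_nonneg _
    calc ε ^ 2 * ‖u t‖ ^ 2 ≤ ε ^ 2 * (4 * Real.exp (4 * κ ^ 2) * N t) := by
          gcongr
          exact hlower t
      _ = ε ^ 2 * (4 * Real.exp (4 * κ ^ 2)) * N t := by ring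
      _ ≤ 1 / 4 * N t := by gcongr
      _ = _ := by ring
  have hwi : ∀ t, IntervalIntegrable (w t) volume 0 1 := fun t =>
    (hwm t).intervalIntegrable_of_Icc zero_le_one
  let q : ℝ → ℝ := concatAt 1 (w 0) W
  have hNq : ∀ T, 0 ≤ T → N T = ∫ z in T..T + 1, q z ^ 2 := by
    intro T hT
    -- The weak formulation speaks of `T > 0` only; at `T = 0` the first window of `q` is `w 0` by
    -- construction.
    rcases hT.eq_or_lt with rfl | hT0
    · rw [zero_add]
      refine intervalIntegral.integral_congr_Ioo_of_le zero_le_one fun z hz => ?_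
      simp only [q, concatAt, if_pos hz.2.le]
    · exact integral_sq_eq_of_exponential_moments hT (hwi 0) (hwi T) (hb T hT0) (hWi T hT)
        (hmom T hT0)
  have hq : ∀ a c, 0 ≤ a → a ≤ c → IntervalIntegrable (fun z => q z ^ 2) volume a c := by
    intro a c ha hac
    have h1 := intervalIntegrable_concatAt (c := 1) (d := c) zero_le_one (ha.trans hac)
      ((hwm 0).intervalIntegrable_sq_of_Icc zero_le_one)
      (((hWc.pow 2).mono Icc_subset_Ici_self).intervalIntegrable_of_Icc (ha.trans hac))
    refine ((h1.1.trans h1.2).congr_ae (Filter.Eventually.of_forall fun z => ?_)).mono_set ?_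
    · exact (concatAt_comp₂ (fun x _ => x ^ 2) id z).symm
    · rw [uIcc_of_le hac, uIcc_of_le (by linarith)]
      exact Icc_subset_Icc ha (by linarith)
  have hdecay := decay_of_window_bound hq hNq (fun z hz => by
    simp only [q, concatAt, if_neg hz.not_ge]
    exact hW (z - 1)) ht
  set e := Real.exp (4 * κ ^ 2) with he
  have hsq : ‖u t‖ ^ 2 ≤ (Real.sqrt (32 * e * (1 + κ ^ 2))
      * Real.exp (-Real.log 2 * t / 2) * ‖u 0‖) ^ 2 := by
    rw [mul_pow, mul_pow, Real.sq_sqrt (by positivity), ← Real.exp_nat_mul]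
    have hexp : ((2 : ℕ) : ℝ) * (-Real.log 2 * t / 2) = -Real.log 2 * t := by
      push_cast
      ring
    rw [hexp]
    calc ‖u t‖ ^ 2 ≤ 4 * e * N t := hlower t
      _ ≤ 4 * e * (4 * Real.exp (-Real.log 2 * t) * (2 * (1 + κ ^ 2) * ‖u 0‖ ^ 2)) := by
        gcongr
        refine hdecay.trans ?_
        gcongr
        exact hupper 0
      _ = _ := by ring
  exact (abs_le_of_sq_le_sq' hsq (by positivity)).2

theorem mainTheorem3 (Bg Bg' Bf Bfx : ℝ) (hBg : 0 < Bg) (hBg' : 0 < Bg')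
    (hBf : 0 < Bf) (hBfx : 0 < Bfx) :
    ∃ εstar : ℝ, 0 < εstar ∧
      ∀ (g : ℝ → ℝ) (f : ℝ × ℝ → ℝ),
        ContDiffOn ℝ 1 g (Set.Icc 0 1) →
        ContDiffOn ℝ 1 f triangle →
        (∃ L, LipschitzOnWith L (derivWithin g (Set.Icc 0 1)) (Set.Icc 0 1)) →
        (∃ L, LipschitzOnWith L (partialX f) triangle) →
        (∃ L, LipschitzOnWith L (partialY f) triangle) →
        (∀ x ∈ Set.Icc (0 : ℝ) 1, |g x| ≤ Bg) →
        (∀ x ∈ Set.Icc (0 : ℝ) 1, |derivWithin g (Set.Icc 0 1) x| ≤ Bg') →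
        (∀ p ∈ triangle, |f p| ≤ Bf) →
        (∀ p ∈ triangle, |partialX f p| ≤ Bfx) →
        ∃ k : ℝ × ℝ → ℝ, IsBacksteppingKernel g f k ∧
          (∀ k', IsBacksteppingKernel g f k' → Set.EqOn k' k triangle) ∧
          ∀ ε ∈ Set.Ioo 0 εstar, ∀ khat : ℝ × ℝ → ℝ,
            ContDiffOn ℝ 1 khat triangle → ApproximatesWithin ε k khat →
            ∃ M cstar : ℝ, 0 < M ∧ 0 < cstar ∧
              ∀ u : ℝ → StateL2, IsClosedLoopSolution g f khat u →
                ∀ t : ℝ, 0 ≤ t → ‖u t‖ ≤ M * Real.exp (-cstar * t / 2) * ‖u 0‖ := by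
  set κ := 2 * (Bg + Bf) * Real.exp (2 * (Bg + Bf)) with hκ
  have hκ0 : 0 < κ := by positivity
  -- This threshold is the solution of `ε² * (4 * exp (4κ²)) = 1/4`, the smallness needed for the
  -- window bound.
  refine ⟨Real.exp (-(2 * κ ^ 2)) / 4, by positivity, ?_⟩
  intro g f hg hf _ _ _ hgB _ hfB _
  obtain ⟨G, G', hG', hGd, hGeq⟩ := hg.exists_hasDerivAt_extension_Icc
  obtain ⟨F, Fz, hF, hFz, hFd, hFeq⟩ := hf.exists_hasDerivAt_extension_triangle
  obtain ⟨K, Ky, hK, hKy, hKd, hKyeq, hKeq, hKb, hKu⟩ := exists_contDiff_kernel hG' hGd hF hFz hFd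
    (fun z hz => by rw [hGeq hz]; exact hgB z hz)
    (fun q hq => by rw [hFeq q hq]; exact hfB _ (add_mem_triangle hq)) hBg hBf
  have hchar : CharacteristicKernel G F K Ky :=
    ⟨continuous_iff_continuousAt.2 fun z => (hGd z).continuousAt, hF, hK.continuous, hKy, hKd,
      hKyeq, hKeq⟩
  refine ⟨shear K, isBacksteppingKernel_of_eqOn_kernelOp hGeq hFeq hK hKeq, ?_, ?_⟩
  · rintro k' hk' ⟨x, y⟩ hp
    have h1 := hKu _ (hk'.contDiffOn.continuousOn.comp (by fun_prop) fun q hq =>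
      add_mem_triangle hq) (hk'.eqOn_kernelOp hGeq hFeq) (sub_mem_cornerSimplex hp)
    simpa only [shear, Function.comp_apply, sub_add_cancel] using h1
  · intro ε hε khat hkhat happrox
    refine ⟨Real.sqrt (32 * Real.exp (4 * κ ^ 2) * (1 + κ ^ 2)), Real.log 2, by positivity,
      Real.log_pos one_lt_two, fun u hu t ht => ?_⟩
    refine hchar.norm_le_mul_exp (ε := ε) hGeq hFeq hκ0
      (fun p hp => hKb _ (sub_mem_cornerSimplex hp)) hkhat.continuousOn (fun y hy => ?_) ?_ hu ht
    · have h1 := happrox (1, y) ⟨hy.1, hy.2, le_rfl⟩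
      rw [abs_sub_comm]
      linarith [abs_nonneg (partialX (fun q => shear K q - khat q) (1, y)),
        abs_nonneg (partialY (fun q => shear K q - khat q) (1, y))]
    · have h1 : ε ^ 2 ≤ (Real.exp (-(2 * κ ^ 2)) / 4) ^ 2 := by
        have := hε.1.le
        have := hε.2.le
        gcongr
      calc ε ^ 2 * (4 * Real.exp (4 * κ ^ 2))
          ≤ (Real.exp (-(2 * κ ^ 2)) / 4) ^ 2 * (4 * Real.exp (4 * κ ^ 2)) := by gcongr
        _ = 1 / 4 * (Real.exp (-(2 * κ ^ 2)) * Real.exp (-(2 * κ ^ 2))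
            * Real.exp (4 * κ ^ 2)) := by ring
        _ = 1 / 4 := by
          rw [← Real.exp_add, ← Real.exp_add]
          ring_nf
          simp
        _ ≤ 1 / 4 := le_rfl
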